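/- Setting. Let $(\Omega,\mathcal F,P)$ be a probability space, $\langle\cdot\rangle=\int_\Omega\cdot\,dP$, and let $(\tau_x)_{x\in\mathbb R^d}$ be a group of maps $\tau_x:\Omega\to\Omega$ ($\tau_0=\mathrm{Id}$, $\tau_{x+y}=\tau_x\circ\tau_y$), each of them measurable and $P$-preserving, such that $(\omega,x)\mapsto\tau_x\omega$ is $(\mathcal F\otimes\mathcal L(\mathbb R^d),\mathcal F)$-measurable, where $\mathcal L(\mathbb R^d)$ is the Lebesgue $\sigma$-algebra. Assume ergodicity: every $A\in\mathcal F$ with $\tau_xA=A$ for all $x$ satisfies $P(A)\in\{0,1\}$. Let $p\in(1,\infty)$, $\frac1p+\frac1q=1$, and let $Q\subset\mathbb R^d$ be open and bounded. Let $\mathscr D_\Omega$ be a countable set of bounded measurable functions on $\Omega$ and $\mathscr D_Q\subset C(\overline Q)$ a countable set, both containing the constant function $1$, such that for every $1\le r<\infty$, $\mathscr D_\Omega$ is dense in $L^r(\Omega)$ and $\mathscr D_Q$ is dense in $L^r(Q)$. Put $\mathscr A=\{a(\omega)b(x): a\in\mathscr D_\Omega,\ b\in\mathscr D_Q\}$,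 $\mathscr D=\operatorname{span}\mathscr A$ and $(\mathcal T_\varepsilon^*\varphi)(\omega,x)=\varphi(\tau_{x/\varepsilon}\omega,x)$. Call $\omega_0\in\Omega$ admissible if for all $\varphi,\varphi'\in\mathscr A$ and $r\in\{p,q\}$ $$\limsup_{\varepsilon\downarrow0}\|(\mathcal T_\varepsilon^*\varphi)(\omega_0,\cdot)\|_{L^r(Q)}\le\|\varphi\|_{L^r(\Omega\times Q)},\qquad \lim_{\varepsilon\downarrow0}\int_Q\mathcal T_\varepsilon^*(\varphi\varphi')(\omega_0,x)\,dx=\Big\langle\int_Q(\varphi\varphi')(\cdot,x)\,dx\Big\rangle .$$ Given scales $\varepsilon_n>0$ with $\varepsilon_n\to0$, a sequence $(u_n)$ in $L^p(Q)$ converges quenched $\omega_0$-two-scale (along $(\varepsilon_n)$) to $u\in L^p(\Omega\times Q)$ if it is bounded in $L^p(Q)$ and for all $\varphi\in\mathscr D$ $$\lim_{n\to\infty}\int_Q u_n(x)\,(\mathcal T_{\varepsilon_n}^*\varphi)(\omega_0,x)\,dx=\int_\Omega\int_Q u(\omega,x)\varphi(\omega,x)\,dx\,dP(\omega).$$ Lemma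 (Compactness). Let $\omega_0$ be admissible, let $\varepsilon_n>0$ with $\varepsilon_n\to0$, and let $(u_n)$ be a bounded sequence in $L^p(Q)$. Then there exist a subsequence $(u_{k_n})$ and $u\in L^p(\Omega\times Q)$ such that $(u_{k_n})$ converges quenched $\omega_0$-two-scale to $u$ along $(\varepsilon_{k_n})$, $$\|u\|_{L^p(\Omega\times Q)}\le\liminf_{n\to\infty}\|u_n\|_{L^p(Q)}$$ (the liminf over the whole sequence, which is at most that along the subsequence), and $u_{k_n}\rightharpoonup\langle u\rangle$ weakly in $L^p(Q)$, where $\langle u\rangle(x)=\int_\Omega u(\omega,x)\,dP(\omega)\in L^p(Q)$. -/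

import Mathlib

open MeasureTheory Filter Topology
open scoped ENNReal

noncomputable section

/-- The physical space `ℝ^d`. -/
abbrev PhysSpace (d : ℕ) : Type := EuclideanSpace ℝ (Fin d)

/-- The product measure `P ⊗ dx` on `Ω × Q`. -/
abbrev cylMeasure {d : ℕ} {Ω : Type*} [MeasurableSpace Ω] (P : Measure Ω)
    (Q : Set (PhysSpace d)) : Measure (Ω × PhysSpace d) :=
  P.prod (volume.restrict Q)

/-- A measure preserving action `(τ_x)_{x ∈ ℝ^d}` of the group `ℝ^d` on `(Ω, P)`. -/
structure IsMeasurePreservingFlow {d : ℕ} {Ω : Type*} [MeasurableSpace Ω] (P : Measure Ω)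
    (τ : PhysSpace d → Ω → Ω) : Prop where
  zero : ∀ ω, τ 0 ω = ω
  add : ∀ x y ω, τ (x + y) ω = τ x (τ y ω)
  measurePreserving : ∀ x, MeasurePreserving (τ x) P P
  /-- `(ω, x) ↦ τ_x ω` is measurable for the product of the σ-algebra of `Ω` with the Lebesgue
  σ-algebra of `ℝ^d` (the σ-algebra of the null-measurable sets). -/
  measurable_joint :
    Measurable fun z : Ω × NullMeasurableSpace (PhysSpace d) volume => τ z.2 z.1

/-- Every measurable set that is invariant under all shifts has probability `0` or `1`. -/
def IsErgodicFlow {d : ℕ} {Ω : Type*} [MeasurableSpace Ω] (P : Measure Ω)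
    (τ : PhysSpace d → Ω → Ω) : Prop :=
  ∀ A : Set Ω, MeasurableSet A → (∀ x, τ x '' A = A) → P A = 0 ∨ P A = 1

/-- The set `S` of functions is dense in `L^r(μ)`. -/
def DenseInLp {α : Type*} [MeasurableSpace α] (μ : Measure α) (r : ℝ≥0∞)
    (S : Set (α → ℝ)) : Prop :=
  ∀ f : α → ℝ, MemLp f r μ → ∀ δ : ℝ≥0∞, 0 < δ → ∃ g ∈ S, eLpNorm (f - g) r μ < δ

/-- The requirements on the set `𝒟_Ω` of test functions of the random variable. -/
structure IsRandomTestSet {Ω : Type*} [MeasurableSpace Ω] (P : Measure Ω)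
    (DΩ : Set (Ω → ℝ)) : Prop where
  countable : DΩ.Countable
  measurable : ∀ a ∈ DΩ, Measurable a
  bounded : ∀ a ∈ DΩ, ∃ C : ℝ, ∀ ω, |a ω| ≤ C
  one_mem : (fun _ => 1) ∈ DΩ
  dense : ∀ r : ℝ≥0∞, 1 ≤ r → r ≠ ∞ → DenseInLp P r DΩ

/-- The requirements on the set `𝒟_Q ⊆ C(closure Q)` of test functions of the space variable;
only the values on `closure Q` matter. -/
structure IsSpatialTestSet {d : ℕ} (Q : Set (PhysSpace d))
    (DQ : Set (PhysSpace d → ℝ)) : Prop where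
  countable : DQ.Countable
  continuousOn : ∀ b ∈ DQ, ContinuousOn b (closure Q)
  one_mem : (fun _ => 1) ∈ DQ
  dense : ∀ r : ℝ≥0∞, 1 ≤ r → r ≠ ∞ → DenseInLp (volume.restrict Q) r DQ

/-- The set `𝒜` of the simple tensor products `φ(ω, x) = a(ω) b(x)`, `a ∈ 𝒟_Ω`, `b ∈ 𝒟_Q`. -/
def simpleTensors {d : ℕ} {Ω : Type*} (DΩ : Set (Ω → ℝ)) (DQ : Set (PhysSpace d → ℝ)) :
    Set (Ω × PhysSpace d → ℝ) :=
  {φ | ∃ a ∈ DΩ, ∃ b ∈ DQ, φ = fun z => a z.1 * b z.2}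

/-- The space `𝒟` of test functions: the linear span of `𝒜`. Its elements are functions, not
classes of functions modulo null sets. -/
def testSpace {d : ℕ} {Ω : Type*} (DΩ : Set (Ω → ℝ)) (DQ : Set (PhysSpace d → ℝ)) :
    Submodule ℝ (Ω × PhysSpace d → ℝ) :=
  Submodule.span ℝ (simpleTensors DΩ DQ)

/-- `(T_ε^* φ)(ω, x) = φ(τ_{x/ε} ω, x)`. -/
def unfoldAdj {d : ℕ} {Ω : Type*} (τ : PhysSpace d → Ω → Ω) (ε : ℝ)
    (φ : Ω × PhysSpace d → ℝ) (ω : Ω) (x : PhysSpace d) : ℝ :=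
  φ (τ (ε⁻¹ • x) ω, x)

/-- The set of admissible realizations: along the orbit of `ω₀`, the oscillating test functions
have the right asymptotic norms (in `L^p` and `L^q`) and correlations as `ε → 0`. -/
def admissibleSet {d : ℕ} {Ω : Type*} [MeasurableSpace Ω] (P : Measure Ω)
    (τ : PhysSpace d → Ω → Ω) (p q : ℝ≥0∞) (Q : Set (PhysSpace d))
    (DΩ : Set (Ω → ℝ)) (DQ : Set (PhysSpace d → ℝ)) : Set Ω :=
  {ω₀ | (∀ φ ∈ simpleTensors DΩ DQ, ∀ r : ℝ≥0∞, (r = p ∨ r = q) →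
          limsup (fun ε : ℝ => eLpNorm (unfoldAdj τ ε φ ω₀) r (volume.restrict Q)) (𝓝[>] 0)
            ≤ eLpNorm φ r (cylMeasure P Q)) ∧
        (∀ φ ∈ simpleTensors DΩ DQ, ∀ φ' ∈ simpleTensors DΩ DQ,
          Tendsto (fun ε : ℝ => ∫ x in Q, unfoldAdj τ ε (φ * φ') ω₀ x) (𝓝[>] 0)
            (𝓝 (∫ z, φ z * φ' z ∂(cylMeasure P Q))))}

/-- The sequence `u_n ∈ L^p(Q)`, with scales `ε_n`, converges (weakly, quenched) `ω₀`-two-scale to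
`v ∈ L^p(Ω × Q)`. -/
def QuenchedTwoScale {d : ℕ} {Ω : Type*} [MeasurableSpace Ω] (P : Measure Ω)
    (τ : PhysSpace d → Ω → Ω) {p : ℝ≥0∞} (Q : Set (PhysSpace d))
    (DΩ : Set (Ω → ℝ)) (DQ : Set (PhysSpace d → ℝ)) (ω₀ : Ω) (ε : ℕ → ℝ)
    (u : ℕ → Lp ℝ p (volume.restrict Q)) (v : Lp ℝ p (cylMeasure P Q)) : Prop :=
  (∃ C : ℝ, ∀ n, ‖u n‖ ≤ C) ∧
  ∀ φ ∈ testSpace DΩ DQ,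
    Tendsto (fun n => ∫ x in Q, u n x * unfoldAdj τ (ε n) φ ω₀ x) atTop
      (𝓝 (∫ z, v z * φ z ∂(cylMeasure P Q)))

/-- The expectation `⟨v⟩(x) = ∫ v(ω, x) dP(ω)`. -/
def expectation {d : ℕ} {Ω : Type*} [MeasurableSpace Ω] (P : Measure Ω)
    (v : Ω × PhysSpace d → ℝ) (x : PhysSpace d) : ℝ :=
  ∫ ω, v (ω, x) ∂P

end

/-!
The limit is found by duality. Along a subsequence, the pairings of `u_n` with the oscillating test
functions `T_ε^* φ` converge for every `φ` in the span of the countable set `𝒜`, to a linear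
functional `L` of `φ`. If `|L φ| ≤ liminf ‖u_n‖ * ‖φ‖_{L^q(Ω × Q)}`, then `L` extends to
`L^q(Ω × Q)` by Hahn–Banach and is the pairing with some `v ∈ L^p(Ω × Q)` with the right norm, by the Riesz
representation theorem for `L^q` (`exists_Lp_dual_repr`). Weak convergence to `⟨v⟩` is then the case
of test functions that depend only on the space variable, which are dense in `L^q(Q)`.

By Hölder, the estimate of `L` follows from `limsup ‖T_ε^* φ‖_{L^q(Q)} ≤ ‖φ‖_{L^q(Ω × Q)}`. The
difficulty is that admissibility gives this bound only for simple tensors `φ = a ⊗ b`, while the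
span is needed (`IsGenericFamily.limsup_eLpNorm_sum_le`). The bound is extended as follows.
* Approximating the indicator function of a set `K ⊆ Q` by spatial test functions localizes the
  bound for `a ∈ 𝒟_Ω` to `K`.
* For a linear combination `s` of random test functions, the correlations give
  `‖T_ε^* s‖_{L²(Q)} → ‖s‖_{L²}`. As `𝒟_Ω` itself is dense, there is `a ∈ 𝒟_Ω` close to `s` both in
  `L²` and in `L^q`, so that `T_ε^* s` is asymptotically close in `L²` to `T_ε^* a`, whose
  `L^q` norm is controlled. As `s` is bounded, closeness in `L²` is enough to bound the `L^q` norm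
  of `T_ε^* s`, also for `q > 2` (`exists_enorm_rpow_le`).
* In `φ = ∑ a_k ⊗ b_k`, the `b_k` are approximated in `L^q` by simple functions on a common
  partition of `Q`. On each cell of the partition, `φ` is then a linear combination of random test
  functions.
-/

/-! ### Duality of `L^p` spaces over a finite measure -/

/-- A continuous linear functional on `L^q` of a finite measure is countably additive on
indicator functions. -/
theorem hasSum_apply_indicatorConstLp {α : Type*} [MeasurableSpace α] {μ : Measure α}
    [IsFiniteMeasure μ] {q : ℝ≥0∞} [Fact (1 ≤ q)] (hq : q ≠ ∞)
    (Λ : StrongDual ℝ (Lp ℝ q μ)) {s : ℕ → Set α} (hs : ∀ i, MeasurableSet (s i))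
    (hd : Pairwise (Function.onFun Disjoint s)) :
    HasSum (fun i => Λ (indicatorConstLp q (hs i) (measure_ne_top μ _) 1))
      (Λ (indicatorConstLp q (MeasurableSet.iUnion hs) (measure_ne_top μ _) 1)) := by
  have hm : ∀ F : Finset ℕ, MeasurableSet (⋃ i ∈ F, s i) := fun F =>
    F.measurableSet_biUnion fun i _ => hs i
  have key : ∀ F : Finset ℕ, ∑ i ∈ F, Λ (indicatorConstLp q (hs i) (measure_ne_top μ _) 1) =
      Λ (indicatorConstLp q (hm F) (measure_ne_top μ _) 1) := by
    intro F
    induction F using Finset.induction_on with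
    | empty => simp [indicatorConstLp_empty]
    | insert a F ha ih =>
      rw [Finset.sum_insert ha, ih, ← map_add, ← indicatorConstLp_disjoint_union]
      · simp only [Finset.set_biUnion_insert]
      · rw [Set.disjoint_iUnion₂_right]
        exact fun i hi => hd fun h => ha (h ▸ hi)
  unfold HasSum
  simp only [SummationFilter.unconditional_filter]
  simp_rw [key]
  refine (Λ.continuous.tendsto _).comp ?_
  refine tendsto_indicatorConstLp_set hq ?_
  have h1 := tendsto_measure_iInter_atTop (μ := μ)
    (s := fun F : Finset ℕ => (⋃ i, s i) \ ⋃ i ∈ F, s i)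
    (fun F => ((MeasurableSet.iUnion hs).diff (hm F)).nullMeasurableSet)
    (fun F G h => Set.sdiff_subset_sdiff_right (Set.biUnion_subset_biUnion_left h))
    ⟨∅, measure_ne_top μ _⟩
  have h2 : (⋂ F : Finset ℕ, (⋃ i, s i) \ ⋃ i ∈ F, s i) = ∅ := by
    ext x
    simp only [Set.mem_iInter, Set.mem_sdiff, Set.mem_iUnion, Set.mem_empty_iff_false, iff_false]
    intro h
    obtain ⟨i, hi⟩ := (h ∅).1
    exact (h {i}).2 ⟨i, by simp, hi⟩
  rw [h2, measure_empty] at h1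
  refine h1.congr fun F => ?_
  have hsub : (⋃ i ∈ F, s i) ⊆ ⋃ i, s i := Set.iUnion₂_subset fun i _ => Set.subset_iUnion s i
  simp [symmDiff, Set.sdiff_eq_empty.2 hsub]

/-- A continuous linear functional on `L^q` of a finite measure has an integrable density, the
Radon–Nikodym derivative of the signed measure `s ↦ Λ 1_s`. -/
theorem exists_integrable_density {α : Type*} [MeasurableSpace α] (μ : Measure α)
    [IsFiniteMeasure μ] {q : ℝ≥0∞} [Fact (1 ≤ q)] (hq : q ≠ ∞)
    (Λ : StrongDual ℝ (Lp ℝ q μ)) :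
    ∃ g : α → ℝ, Measurable g ∧ Integrable g μ ∧ ∀ (s : Set α) (hs : MeasurableSet s),
      Λ (indicatorConstLp q hs (measure_ne_top μ _) 1) = ∫ x in s, g x ∂μ := by
  classical
  let ν : SignedMeasure α :=
    { measureOf' := fun s => if hs : MeasurableSet s then
        Λ (indicatorConstLp q hs (measure_ne_top μ _) 1) else 0
      empty' := by simp [indicatorConstLp_empty]
      not_measurable' := fun s hs => dif_neg hs
      m_iUnion' := fun s hs hd => by
        simpa [hs, MeasurableSet.iUnion hs] using hasSum_apply_indicatorConstLp hq Λ hs hd }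
  have hν : ∀ (s : Set α) (hs : MeasurableSet s),
      ν s = Λ (indicatorConstLp q hs (measure_ne_top μ _) 1) := fun s hs => dif_pos hs
  have hac : ν ≪ᵥ μ.toENNRealVectorMeasure := by
    refine VectorMeasure.AbsolutelyContinuous.mk fun s hs h0 => ?_
    rw [Measure.toENNRealVectorMeasure_apply_measurable hs] at h0
    rw [hν s hs]
    have : indicatorConstLp q hs (measure_ne_top μ s) (1 : ℝ) = 0 := by
      rw [← norm_eq_zero, norm_indicatorConstLp (zero_lt_one.trans_le Fact.out).ne' hq,
        Measure.real, h0]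
      have := ENNReal.toReal_pos (zero_lt_one.trans_le (Fact.out : 1 ≤ q)).ne' hq
      simp [Real.zero_rpow (inv_pos.2 this).ne']
    rw [this, map_zero]
  refine ⟨ν.rnDeriv μ, SignedMeasure.measurable_rnDeriv _ _,
    SignedMeasure.integrable_rnDeriv _ _, fun s hs => ?_⟩
  rw [← hν s hs, ← withDensityᵥ_apply (SignedMeasure.integrable_rnDeriv _ _) hs,
    SignedMeasure.withDensityᵥ_rnDeriv_eq _ _ hac]

/-- If an integrable function represents a functional on indicator functions, it represents it on
bounded functions. -/
theorem apply_toLp_eq_integral_of_bounded {α : Type*} [MeasurableSpace α] {μ : Measure α}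
    [IsFiniteMeasure μ] {q : ℝ≥0∞} [Fact (1 ≤ q)] (hq : q ≠ ∞)
    (Λ : StrongDual ℝ (Lp ℝ q μ)) {g : α → ℝ} (hg : Integrable g μ)
    (h : ∀ (s : Set α) (hs : MeasurableSet s),
      Λ (indicatorConstLp q hs (measure_ne_top μ _) 1) = ∫ x in s, g x ∂μ)
    {f : α → ℝ} (hf : StronglyMeasurable f) {C : ℝ} (hC : ∀ x, ‖f x‖ ≤ C) (hfq : MemLp f q μ) :
    Λ (hfq.toLp f) = ∫ x, g x * f x ∂μ := by
  have hsimple : ∀ φ : SimpleFunc α ℝ,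
      Λ ((φ.memLp_of_isFiniteMeasure q μ).toLp φ) = ∫ x, g x * φ x ∂μ := by
    intro φ
    have hint : ∀ φ : SimpleFunc α ℝ, Integrable (fun x => g x * φ x) μ := fun φ => by
      obtain ⟨C, hC⟩ := φ.exists_forall_norm_le
      exact hg.mul_bdd φ.aestronglyMeasurable (ae_of_all _ hC)
    induction φ using SimpleFunc.induction with
    | @const c s hs =>
      have e : ((SimpleFunc.piecewise s hs (SimpleFunc.const α c)
          (SimpleFunc.const α 0)).memLp_of_isFiniteMeasure q μ).toLp _ =
          c • indicatorConstLp q hs (measure_ne_top μ _) (1 : ℝ) := by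
        refine Lp.ext ?_
        filter_upwards [MemLp.coeFn_toLp ((SimpleFunc.piecewise s hs (SimpleFunc.const α c)
          (SimpleFunc.const α 0)).memLp_of_isFiniteMeasure q μ),
          Lp.coeFn_smul c (indicatorConstLp q hs (measure_ne_top μ _) (1 : ℝ)),
          indicatorConstLp_coeFn (p := q) (hs := hs) (hμs := measure_ne_top μ s) (c := (1 : ℝ))]
          with x h1 h2 h3
        rw [h1, h2, Pi.smul_apply, h3]
        by_cases hx : x ∈ s <;> simp [hx]
      rw [e, map_smul, h s hs, smul_eq_mul, ← integral_indicator hs, ← integral_const_mul]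
      congr 1
      ext x
      by_cases hx : x ∈ s <;> simp [hx, mul_comm]
    | @add φ ψ _ hφ hψ =>
      have e : ((φ + ψ).memLp_of_isFiniteMeasure q μ).toLp _ =
        (φ.memLp_of_isFiniteMeasure q μ).toLp φ + (ψ.memLp_of_isFiniteMeasure q μ).toLp ψ :=
        MemLp.toLp_add (φ.memLp_of_isFiniteMeasure q μ) (ψ.memLp_of_isFiniteMeasure q μ)
      rw [e, map_add, hφ, hψ, ← integral_add (hint φ) (hint ψ)]
      simp [mul_add]
  obtain ⟨K, hK⟩ : ∃ K : NNReal, ∀ x, ‖f x‖ ≤ K :=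
    ⟨C.toNNReal, fun x => (hC x).trans (Real.le_coe_toNNReal C)⟩
  have hlim : ∀ x, Tendsto (fun n => hf.approxBounded K n x) atTop (𝓝 (f x)) :=
    fun x => hf.tendsto_approxBounded_of_norm_le (hK x)
  have hb := hf.norm_approxBounded_le K.coe_nonneg
  have l1 : Tendsto (fun n => ∫ x, g x * hf.approxBounded K n x ∂μ) atTop
      (𝓝 (∫ x, g x * f x ∂μ)) := by
    refine tendsto_integral_of_dominated_convergence (fun x => ‖g x‖ * K)
      (fun n => hg.1.mul (SimpleFunc.aestronglyMeasurable _)) (hg.norm.mul_const _)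
      (fun n => ae_of_all _ fun x => ?_) (ae_of_all _ fun x => (hlim x).const_mul _)
    rw [norm_mul]
    gcongr
    exact hb n x
  have l2 : Tendsto (fun n =>
      ((hf.approxBounded K n).memLp_of_isFiniteMeasure q μ).toLp _) atTop
      (𝓝 (hfq.toLp f)) := by
    rw [Lp.tendsto_Lp_iff_tendsto_eLpNorm'']
    refine tendsto_Lp_finite_of_tendsto_ae Fact.out hq
      (fun n => SimpleFunc.aestronglyMeasurable _) hfq ?_ (ae_of_all _ hlim)
    refine unifIntegrable_of Fact.out hq (fun n => SimpleFunc.aestronglyMeasurable _)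
      fun ε hε => ⟨K + 1, fun n => ?_⟩
    have : {x | K + 1 ≤ ‖hf.approxBounded K n x‖₊} = ∅ := by
      ext x
      simp only [Set.mem_ofPred_eq, Set.mem_empty_iff_false, iff_false, not_le]
      exact lt_of_le_of_lt (show _ ≤ K from hb n x) (lt_add_one _)
    rw [this]
    simp
  refine tendsto_nhds_unique ((Λ.continuous.tendsto _).comp l2) (l1.congr fun n => ?_)
  exact (hsimple _).symm

/-- **Riesz representation**: every continuous linear functional on `L^q` of a finite measure is
the pairing with an element of `L^p` whose norm is at most that of the functional. -/
theorem exists_Lp_dual_repr {α : Type*} [MeasurableSpace α] (μ : Measure α)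
    [IsFiniteMeasure μ] {p q : ℝ≥0∞} [Fact (1 ≤ p)] [Fact (1 ≤ q)] [ENNReal.HolderConjugate p q]
    (hp : p ≠ ∞) (hq : q ≠ ∞) (Λ : StrongDual ℝ (Lp ℝ q μ)) :
    ∃ g : Lp ℝ p μ, ‖g‖ ≤ ‖Λ‖ ∧ ∀ f : Lp ℝ q μ, Λ f = ∫ x, g x * f x ∂μ := by
  obtain ⟨g, hgm, hgi, hg⟩ := exists_integrable_density μ hq Λ
  have hp0 : p ≠ 0 := (zero_lt_one.trans_le (Fact.out : 1 ≤ p)).ne'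
  have hq0 : q ≠ 0 := (zero_lt_one.trans_le (Fact.out : 1 ≤ q)).ne'
  have hpq : p.toReal.HolderConjugate q.toReal := ENNReal.HolderConjugate.toReal_of_ne_top hp hq
  set r := p.toReal
  set s := q.toReal
  -- truncations of the density
  let t : ℕ → α → ℝ := fun N => {x | |g x| ≤ N}.indicator g
  have htm : ∀ N, Measurable (t N) := fun N =>
    hgm.indicator (measurableSet_le (by fun_prop) measurable_const)
  have htb : ∀ N x, |t N x| ≤ N := fun N x => by
    by_cases hx : |g x| ≤ N
    · simp [t, hx]
    · simp [t, hx]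
  have hmem : ∀ N (e : ℝ≥0∞), MemLp (t N) e μ := fun N e =>
    MemLp.of_bound (htm N).aestronglyMeasurable N (ae_of_all _ (htb N))
  have htr : ∀ N, eLpNorm (t N) p μ ≤ ENNReal.ofReal ‖Λ‖ := by
    intro N
    -- testing with `|t|^(p-2) t` turns the functional into the `p`-th power of the norm of `t`
    let f : α → ℝ := fun x => t N x * |t N x| ^ (r - 2)
    have hfabs : ∀ x, |f x| = |t N x| ^ (r - 1) := fun x => by
      rcases eq_or_ne (t N x) 0 with h0 | h0
      · simp [f, h0, Real.zero_rpow hpq.sub_one_pos.ne']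
      · have : r - 1 = 1 + (r - 2) := by ring
        simp only [f, abs_mul, abs_of_nonneg (Real.rpow_nonneg (abs_nonneg (t N x)) (r - 2))]
        rw [this, Real.rpow_add (abs_pos.2 h0), Real.rpow_one]
    have hfm : Measurable f := (htm N).mul ((htm N).abs.pow_const _)
    have hfb : ∀ x, ‖f x‖ ≤ (N : ℝ) ^ (r - 1) := fun x => by
      rw [Real.norm_eq_abs, hfabs]
      exact Real.rpow_le_rpow (abs_nonneg _) (htb N x) hpq.sub_one_pos.le
    have hfq : MemLp f q μ := MemLp.of_bound hfm.aestronglyMeasurable _ (ae_of_all _ hfb)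
    have h1 := apply_toLp_eq_integral_of_bounded hq Λ hgi hg hfm.stronglyMeasurable hfb hfq
    set I := ∫ x, |t N x| ^ r ∂μ with hI
    have hI0 : 0 ≤ I := integral_nonneg fun x => Real.rpow_nonneg (abs_nonneg _) _
    have h2 : ∫ x, g x * f x ∂μ = I := by
      congr 1
      ext x
      by_cases hx : |g x| ≤ N
      · have hx' : t N x = g x := by simp [t, hx]
        simp only [f, hx']
        rcases eq_or_ne (g x) 0 with h0 | h0
        · simp [h0, Real.zero_rpow hpq.pos.ne']
        · rw [← mul_assoc, ← abs_mul_abs_self, ← sq, ← Real.rpow_natCast,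
            ← Real.rpow_add (abs_pos.2 h0)]
          norm_num
      · have hx' : t N x = 0 := by simp [t, hx]
        simp [f, hx', Real.zero_rpow hpq.pos.ne']
    have h3 : ‖hfq.toLp f‖ = I ^ s⁻¹ := by
      rw [Lp.norm_toLp, hfq.eLpNorm_eq_integral_rpow_norm hq0 hq, ENNReal.toReal_ofReal]
      · congr 2
        ext x
        rw [Real.norm_eq_abs, hfabs, ← Real.rpow_mul (abs_nonneg _), hpq.sub_one_mul_conj]
      · positivity
    have h4 : I ≤ ‖Λ‖ * I ^ s⁻¹ := by
      have := (le_abs_self _).trans (Λ.le_opNorm (hfq.toLp f))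
      rwa [h1, h2, h3] at this
    have h5 : I ^ r⁻¹ ≤ ‖Λ‖ := by
      rcases hI0.eq_or_lt with h0 | h0
      · rw [← h0, Real.zero_rpow (inv_pos.2 hpq.pos).ne']
        exact norm_nonneg _
      · have : r⁻¹ = 1 - s⁻¹ := hpq.symm.one_sub_inv.symm
        rw [this, Real.rpow_sub h0, Real.rpow_one]
        exact (div_le_iff₀ (Real.rpow_pos_of_pos h0 _)).2 h4
    rw [(hmem N p).eLpNorm_eq_integral_rpow_norm hp0 hp]
    exact ENNReal.ofReal_le_ofReal h5
  have hgp : eLpNorm g p μ ≤ ENNReal.ofReal ‖Λ‖ := by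
    refine (Lp.eLpNorm_lim_le_liminf_eLpNorm (fun N => (htm N).aestronglyMeasurable) g
      (ae_of_all _ fun x => ?_)).trans
      ((liminf_le_liminf (Eventually.of_forall htr)).trans_eq (liminf_const _))
    refine tendsto_const_nhds.congr' ?_
    filter_upwards [eventually_ge_atTop ⌈|g x|⌉₊] with N hN
    simp [t, Nat.ceil_le.1 hN]
  have hgL : MemLp g p μ := ⟨hgm.aestronglyMeasurable, hgp.trans_lt ENNReal.ofReal_lt_top⟩
  refine ⟨hgL.toLp g, ?_, ?_⟩
  · rw [Lp.norm_toLp]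
    exact ENNReal.toReal_le_of_le_ofReal (norm_nonneg _) hgp
  · have e : Λ = (ContinuousLinearMap.mul ℝ ℝ).lpPairing μ p q (hgL.toLp g) := by
      ext f
      induction f using Lp.induction hq with
      | @indicatorConst c s hs hμs =>
        have e : (Lp.simpleFunc.indicatorConst q hs hμs.ne c : Lp ℝ q μ) =
            c • indicatorConstLp q hs (measure_ne_top μ _) (1 : ℝ) := by
          rw [Lp.simpleFunc.coe_indicatorConst]
          refine Lp.ext ?_
          filter_upwards [Lp.coeFn_smul c (indicatorConstLp q hs (measure_ne_top μ _) (1 : ℝ)),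
            indicatorConstLp_coeFn (p := q) (hs := hs) (hμs := measure_ne_top μ s) (c := (1 : ℝ)),
            indicatorConstLp_coeFn (p := q) (hs := hs) (hμs := measure_ne_top μ s) (c := c)]
            with x h1 h2 h3
          rw [h1, h3, Pi.smul_apply, h2]
          by_cases hx : x ∈ s <;> simp [hx]
        rw [e, map_smul, map_smul, hg s hs, ContinuousLinearMap.lpPairing_eq_integral,
          ← integral_indicator hs]
        congr 1
        refine integral_congr_ae ?_
        filter_upwards [hgL.coeFn_toLp,
          indicatorConstLp_coeFn (p := q) (hs := hs) (hμs := measure_ne_top μ s) (c := (1 : ℝ))]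
          with x h1 h2
        rw [h1, h2]
        by_cases hx : x ∈ s <;> simp [hx]
      | add hf hg _ h1 h2 => rw [map_add, map_add, h1, h2]
      | isClosed => exact isClosed_eq Λ.continuous (ContinuousLinearMap.continuous _)
    intro f
    rw [e, ContinuousLinearMap.lpPairing_eq_integral]
    rfl

/-! ### Upper limits in `ℝ≥0∞` -/

theorem ENNReal.limsup_le_add_of_le {ι : Type*} {l : Filter ι} {f g h : ι → ℝ≥0∞} {A B : ℝ≥0∞}
    (hfgh : ∀ i, f i ≤ g i + h i) (hg : limsup g l ≤ A) (hh : limsup h l ≤ B) :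
    limsup f l ≤ A + B := by
  refine ENNReal.le_of_forall_pos_le_add fun ε hε hAB => ?_
  have hε2 : (ε / 2 : ℝ≥0∞) ≠ 0 := by simpa using hε.ne'
  have hA : A ≠ ∞ := (le_self_add.trans_lt hAB).ne
  have hB : B ≠ ∞ := (le_add_self.trans_lt hAB).ne
  have h1 := eventually_lt_of_limsup_lt (hg.trans_lt (ENNReal.lt_add_right hA hε2))
  have h2 := eventually_lt_of_limsup_lt (hh.trans_lt (ENNReal.lt_add_right hB hε2))
  refine limsup_le_of_le (by isBoundedDefault) ?_
  filter_upwards [h1, h2] with i h1 h2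
  calc f i ≤ g i + h i := hfgh i
    _ ≤ (A + ε / 2) + (B + ε / 2) := add_le_add h1.le h2.le
    _ = A + B + (ε / 2 + ε / 2) := by ring
    _ = A + B + ε := by rw [ENNReal.add_halves]

theorem ENNReal.limsup_sum_le {ι κ : Type*} {l : Filter ι} (F : Finset κ) {f : κ → ι → ℝ≥0∞}
    {A : κ → ℝ≥0∞} (h : ∀ k ∈ F, limsup (f k) l ≤ A k) :
    limsup (fun i => ∑ k ∈ F, f k i) l ≤ ∑ k ∈ F, A k := by
  classical
  induction F using Finset.induction_on with
  | empty =>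
    simp only [Finset.sum_empty]
    exact limsup_le_of_le (by isBoundedDefault) (Eventually.of_forall fun _ => le_rfl)
  | insert a F ha ih =>
    rw [Finset.sum_insert ha]
    exact ENNReal.limsup_le_add_of_le (fun i => (Finset.sum_insert ha).le)
      (h a (Finset.mem_insert_self _ _)) (ih fun k hk => h k (Finset.mem_insert_of_mem hk))

theorem ENNReal.limsup_rpow {ι : Type*} {l : Filter ι} [NeBot l] (f : ι → ℝ≥0∞) {t : ℝ}
    (ht : 0 ≤ t) : limsup (fun i => f i ^ t) l = limsup f l ^ t :=
  ((ENNReal.monotone_rpow_of_nonneg ht).map_limsup_of_continuousAt f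
    ENNReal.continuous_rpow_const.continuousAt).symm

theorem ENNReal.le_apply_zero_of_forall_pos {x : ℝ≥0∞} {F : ℝ≥0∞ → ℝ≥0∞} (hF : ContinuousAt F 0)
    (h : ∀ δ, 0 < δ → x ≤ F δ) : x ≤ F 0 :=
  ge_of_tendsto (hF.tendsto.mono_left (nhdsWithin_le_nhds (s := Set.Ioi 0)))
    (eventually_mem_nhdsWithin.mono h)

/-! ### Powers of `L^q` norms -/

theorem lintegral_enorm_rpow_eq_eLpNorm_rpow {α : Type*} [MeasurableSpace α] {μ : Measure α}
    {q : ℝ≥0∞} (hq0 : q ≠ 0) (hq : q ≠ ∞) (f : α → ℝ) :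
    ∫⁻ x, ‖f x‖ₑ ^ q.toReal ∂μ = eLpNorm f q μ ^ q.toReal := by
  rw [eLpNorm_eq_lintegral_rpow_enorm_toReal hq0 hq, ← ENNReal.rpow_mul,
    one_div_mul_cancel (ENNReal.toReal_pos hq0 hq).ne', ENNReal.rpow_one]

theorem lintegral_enorm_sq_eq_ofReal {α : Type*} [MeasurableSpace α] {μ : Measure α}
    [IsFiniteMeasure μ] {f : α → ℝ} (hf : AEStronglyMeasurable f μ) {C : ℝ}
    (hC : ∀ x, |f x| ≤ C) :
    ∫⁻ x, ‖f x‖ₑ ^ (2 : ℝ) ∂μ = ENNReal.ofReal (∫ x, f x * f x ∂μ) := by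
  have hf2 : MemLp f 2 μ := MemLp.of_bound hf C (ae_of_all _ hC)
  have hi : Integrable (fun x => f x * f x) μ := hf2.integrable_mul hf2
  rw [ofReal_integral_eq_lintegral_ofReal hi (ae_of_all _ fun x => mul_self_nonneg _)]
  refine lintegral_congr fun x => ?_
  rw [Real.enorm_eq_ofReal_abs, ENNReal.ofReal_rpow_of_nonneg (abs_nonneg _) zero_le_two,
    Real.rpow_two, sq_abs, sq]

theorem eLpNorm_prod_mul {α β : Type*} [MeasurableSpace α] [MeasurableSpace β] {μ : Measure α}
    {ν : Measure β} [SFinite ν] {r : ℝ≥0∞} (hr0 : r ≠ 0) (hr : r ≠ ∞) {a : α → ℝ} {b : β → ℝ}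
    (ha : AEMeasurable a μ) (hb : AEMeasurable b ν) :
    eLpNorm (fun z : α × β => a z.1 * b z.2) r (μ.prod ν) = eLpNorm a r μ * eLpNorm b r ν := by
  simp only [eLpNorm_eq_lintegral_rpow_enorm_toReal hr0 hr, enorm_mul]
  rw [← ENNReal.mul_rpow_of_nonneg _ _ (by positivity), ← lintegral_prod_mul
    (ha.enorm.pow_const _) (hb.enorm.pow_const _)]
  simp only [ENNReal.mul_rpow_of_nonneg _ _ ENNReal.toReal_nonneg]

/-- For bounded `x`, the power `|x|^q` is controlled by `|y|^q` up to a small constant and a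
multiple of the square of `x - y`, whatever the size of `y`. -/
theorem exists_enorm_rpow_le {q : ℝ} (hq : 0 < q) (M : ℝ) {η : ℝ} (hη : 0 < η) :
    ∃ C : ℝ, ∀ x y : ℝ, |x| ≤ M →
      ‖x‖ₑ ^ q ≤ ‖y‖ₑ ^ q + (ENNReal.ofReal η + ENNReal.ofReal C * ‖x - y‖ₑ ^ (2 : ℝ)) := by
  obtain ⟨θ, hθ, hc⟩ : ∃ θ > 0, ∀ x y : ℝ, |x| ≤ M → |x - y| < θ → |x| ^ q ≤ |y| ^ q + η := by
    have hcont : UniformContinuousOn (fun t : ℝ => |t| ^ q) (Set.Icc (-(M + 1)) (M + 1)) :=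
      isCompact_Icc.uniformContinuousOn_of_continuous
        (continuous_abs.rpow_const fun _ => Or.inr hq.le).continuousOn
    obtain ⟨θ, hθ, h⟩ := Metric.uniformContinuousOn_iff.1 hcont η hη
    refine ⟨min θ 1, lt_min hθ one_pos, fun x y hx hxy => ?_⟩
    have hxy1 := hxy.trans_le (min_le_right _ _)
    rw [abs_le] at hx
    have hxy' := abs_lt.1 hxy1
    have := h x ⟨by linarith, by linarith⟩ y ⟨by linarith, by linarith⟩
      (by rw [Real.dist_eq]; exact hxy.trans_le (min_le_left _ _))
    rw [Real.dist_eq, abs_lt] at this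
    linarith
  refine ⟨M ^ q / θ ^ 2, fun x y hx => ?_⟩
  have hM : 0 ≤ M := (abs_nonneg x).trans hx
  have key : |x| ^ q ≤ |y| ^ q + (η + M ^ q / θ ^ 2 * |x - y| ^ (2 : ℝ)) := by
    rcases lt_or_ge |x - y| θ with hlt | hge
    · have := hc x y hx hlt
      have : 0 ≤ M ^ q / θ ^ 2 * |x - y| ^ (2 : ℝ) := by positivity
      linarith
    · have h1 : |x| ^ q ≤ M ^ q := Real.rpow_le_rpow (abs_nonneg _) hx hq.le
      have h2 : M ^ q ≤ M ^ q / θ ^ 2 * |x - y| ^ (2 : ℝ) := by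
        rw [div_mul_eq_mul_div, le_div_iff₀ (by positivity)]
        refine mul_le_mul_of_nonneg_left ?_ (by positivity)
        rw [Real.rpow_two]
        gcongr
      have : 0 ≤ |y| ^ q := by positivity
      linarith
  simp only [Real.enorm_eq_ofReal_abs]
  rw [ENNReal.ofReal_rpow_of_nonneg (abs_nonneg _) hq.le,
    ENNReal.ofReal_rpow_of_nonneg (abs_nonneg _) hq.le,
    ENNReal.ofReal_rpow_of_nonneg (abs_nonneg _) zero_le_two,
    ← ENNReal.ofReal_mul (by positivity), ← ENNReal.ofReal_add (by positivity) (by positivity),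
    ← ENNReal.ofReal_add (by positivity) (by positivity)]
  exact ENNReal.ofReal_le_ofReal key

/-! ### Asymptotic norms of oscillating functions -/

/-- A family of maps `S_i : X → Ω` is generic along a filter if the compositions `a ∘ S_i` have,
for test functions, at most the expected asymptotic `L^q` norms when multiplied by a test function
of the space variable, and exactly the expected asymptotic `L²` norm for linear combinations of
test functions. The maps need not be measurable, only their compositions with measurable
functions. -/
structure IsGenericFamily {ι Ω X : Type*} [MeasurableSpace Ω] [MeasurableSpace X]
    (P : Measure Ω) (μ : Measure X) (q : ℝ≥0∞) (DΩ : Set (Ω → ℝ)) (DQ : Set (X → ℝ))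
    (l : Filter ι) (S : ι → X → Ω) : Prop where
  aestronglyMeasurable : ∀ i (a : Ω → ℝ), Measurable a →
    AEStronglyMeasurable (fun x => a (S i x)) μ
  limsup_le : ∀ a ∈ DΩ, ∀ b ∈ DQ,
    limsup (fun i => eLpNorm (fun x => a (S i x) * b x) q μ) l ≤ eLpNorm a q P * eLpNorm b q μ
  tendsto_sq : ∀ s ∈ Submodule.span ℝ DΩ,
    Tendsto (fun i => ∫⁻ x, ‖s (S i x)‖ₑ ^ (2 : ℝ) ∂μ) l
      (𝓝 ((∫⁻ ω, ‖s ω‖ₑ ^ (2 : ℝ) ∂P) * μ Set.univ))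

theorem IsRandomTestSet.measurable_of_mem_span {Ω : Type*} [MeasurableSpace Ω] {P : Measure Ω}
    {DΩ : Set (Ω → ℝ)} (hD : IsRandomTestSet P DΩ) {s : Ω → ℝ} (hs : s ∈ Submodule.span ℝ DΩ) :
    Measurable s := by
  induction hs using Submodule.span_induction with
  | mem a ha => exact hD.measurable a ha
  | zero => exact measurable_const
  | add a b _ _ ha hb => exact ha.add hb
  | smul c a _ ha => exact ha.const_smul c

theorem IsRandomTestSet.bounded_of_mem_span {Ω : Type*} [MeasurableSpace Ω] {P : Measure Ω}
    {DΩ : Set (Ω → ℝ)} (hD : IsRandomTestSet P DΩ) {s : Ω → ℝ} (hs : s ∈ Submodule.span ℝ DΩ) :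
    ∃ C : ℝ, ∀ ω, |s ω| ≤ C := by
  induction hs using Submodule.span_induction with
  | mem a ha => exact hD.bounded a ha
  | zero => exact ⟨0, fun _ => by simp⟩
  | add a b _ _ ha hb =>
    obtain ⟨A, hA⟩ := ha
    obtain ⟨B, hB⟩ := hb
    exact ⟨A + B, fun ω => (abs_add_le _ _).trans (add_le_add (hA ω) (hB ω))⟩
  | smul c a _ ha =>
    obtain ⟨A, hA⟩ := ha
    refine ⟨|c| * A, fun ω => ?_⟩
    rw [Pi.smul_apply, smul_eq_mul, abs_mul]
    exact mul_le_mul_of_nonneg_left (hA ω) (abs_nonneg c)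

namespace IsGenericFamily

variable {ι Ω X : Type*} [MeasurableSpace Ω] [MeasurableSpace X] {P : Measure Ω}
  [IsProbabilityMeasure P] {μ : Measure X} [IsFiniteMeasure μ] {q : ℝ≥0∞} {DΩ : Set (Ω → ℝ)}
  {DQ : Set (X → ℝ)} {l : Filter ι} [NeBot l] {S : ι → X → Ω}

/-- Localization to a measurable set, whose indicator function is approximated in `L^q` by test
functions. -/
theorem limsup_setLIntegral_le_of_mem (h : IsGenericFamily P μ q DΩ DQ l S)
    (hD : IsRandomTestSet P DΩ) (hQm : ∀ b ∈ DQ, AEStronglyMeasurable b μ)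
    (hQd : DenseInLp μ q DQ) (hq1 : 1 ≤ q) (hq : q ≠ ∞) {a : Ω → ℝ} (ha : a ∈ DΩ) {K : Set X}
    (hK : MeasurableSet K) :
    limsup (fun i => ∫⁻ x in K, ‖a (S i x)‖ₑ ^ q.toReal ∂μ) l ≤
      (∫⁻ ω, ‖a ω‖ₑ ^ q.toReal ∂P) * μ K := by
  have hq0 : q ≠ 0 := (zero_lt_one.trans_le hq1).ne'
  have hqr := ENNReal.toReal_pos hq0 hq
  obtain ⟨C, hC⟩ := hD.bounded a ha
  set A := eLpNorm a q P with hA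
  set k : X → ℝ := K.indicator fun _ => 1
  have hkm : MemLp k q μ := memLp_indicator_const q hK 1 (Or.inr (measure_ne_top μ K))
  have hAt : A ≠ ∞ := (MemLp.of_bound (hD.measurable a ha).aestronglyMeasurable C
    (ae_of_all _ hC)).2.ne
  have main : limsup (fun i => eLpNorm (fun x => a (S i x)) q (μ.restrict K)) l ≤
      A * eLpNorm k q μ := by
    have hδ : ∀ δ : ℝ≥0∞, 0 < δ →
        limsup (fun i => eLpNorm (fun x => a (S i x)) q (μ.restrict K)) l ≤
          A * (eLpNorm k q μ + δ) + ENNReal.ofReal C * δ := by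
      intro δ hδ
      obtain ⟨b, hb, hbk⟩ := hQd k hkm δ hδ
      have hbm := hQm b hb
      have hbn : eLpNorm b q μ ≤ eLpNorm k q μ + δ := by
        have : b = k - (k - b) := by simp
        rw [this]
        exact (eLpNorm_sub_le hkm.1 (hkm.1.sub hbm) hq1).trans (add_le_add le_rfl hbk.le)
      refine ENNReal.limsup_le_add_of_le (g := fun i => eLpNorm (fun x => a (S i x) * b x) q μ)
        (h := fun i => eLpNorm (fun x => a (S i x) * (k - b) x) q μ) (fun i => ?_)
        ((h.limsup_le a ha b hb).trans (mul_le_mul_right hbn _))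
        (limsup_le_of_le (by isBoundedDefault) (Eventually.of_forall fun i => ?_))
      · have hm := h.aestronglyMeasurable i a (hD.measurable a ha)
        rw [← eLpNorm_indicator_eq_eLpNorm_restrict hK]
        have e : K.indicator (fun x => a (S i x)) =
            (fun x => a (S i x) * b x) + fun x => a (S i x) * (k - b) x := by
          ext x
          by_cases hx : x ∈ K
          · simp [k, hx]
            ring
          · simp [k, hx]
        rw [e]
        exact eLpNorm_add_le (hm.mul hbm) (hm.mul (hkm.1.sub hbm)) hq1
      · refine (eLpNorm_le_mul_eLpNorm_of_ae_le_mul (g := k - b) (c := C)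
          (ae_of_all _ fun x => ?_) q).trans (mul_le_mul_right hbk.le _)
        rw [norm_mul]
        exact mul_le_mul_of_nonneg_right (hC _) (norm_nonneg _)
    have := ENNReal.le_apply_zero_of_forall_pos
      (F := fun δ => A * (eLpNorm k q μ + δ) + ENNReal.ofReal C * δ) ?_ hδ
    · simpa using this
    · exact (((ENNReal.continuous_const_mul hAt).comp (continuous_const.add continuous_id)).add
        (ENNReal.continuous_const_mul ENNReal.ofReal_ne_top)).continuousAt
  simp only [lintegral_enorm_rpow_eq_eLpNorm_rpow hq0 hq]
  rw [ENNReal.limsup_rpow _ hqr.le]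
  refine (ENNReal.rpow_le_rpow main hqr.le).trans_eq ?_
  rw [ENNReal.mul_rpow_of_nonneg _ _ hqr.le, ← lintegral_enorm_rpow_eq_eLpNorm_rpow hq0 hq k,
    ← hA]
  congr 1
  have : (fun x => ‖k x‖ₑ ^ q.toReal) = K.indicator fun _ => 1 := by
    ext x
    by_cases hx : x ∈ K <;> simp [k, hx, hqr]
  rw [this, lintegral_indicator_const hK, one_mul]

/-- Passage from test functions to their linear combinations: such a combination `s` is
approximated by test functions `a`, and the errors `(s - a) ∘ S_i` are small in `L²`. -/
theorem limsup_setLIntegral_le_of_mem_span (h : IsGenericFamily P μ q DΩ DQ l S)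
    (hD : IsRandomTestSet P DΩ) (hQm : ∀ b ∈ DQ, AEStronglyMeasurable b μ)
    (hQd : DenseInLp μ q DQ) (hq1 : 1 ≤ q) (hq : q ≠ ∞) {s : Ω → ℝ}
    (hs : s ∈ Submodule.span ℝ DΩ) {K : Set X} (hK : MeasurableSet K) :
    limsup (fun i => ∫⁻ x in K, ‖s (S i x)‖ₑ ^ q.toReal ∂μ) l ≤
      (∫⁻ ω, ‖s ω‖ₑ ^ q.toReal ∂P) * μ K := by
  have hq0 : q ≠ 0 := (zero_lt_one.trans_le hq1).ne'
  have hqr := ENNReal.toReal_pos hq0 hq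
  obtain ⟨M, hM⟩ := hD.bounded_of_mem_span hs
  have hsm := hD.measurable_of_mem_span hs
  have hsL : ∀ r, MemLp s r P := fun r => MemLp.of_bound hsm.aestronglyMeasurable M
    (ae_of_all _ hM)
  set N := eLpNorm s q P with hN
  have hη : ∀ η : ℝ, 0 < η →
      limsup (fun i => ∫⁻ x in K, ‖s (S i x)‖ₑ ^ q.toReal ∂μ) l ≤
        N ^ q.toReal * μ K + ENNReal.ofReal η * μ K := by
    intro η hη
    obtain ⟨C, hC⟩ := exists_enorm_rpow_le hqr M hη
    have hδ : ∀ δ : ℝ≥0∞, 0 < δ →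
        limsup (fun i => ∫⁻ x in K, ‖s (S i x)‖ₑ ^ q.toReal ∂μ) l ≤
          (N + δ) ^ q.toReal * μ K + (ENNReal.ofReal η * μ K +
            ENNReal.ofReal C * (δ ^ (2 : ℝ) * μ Set.univ)) := by
      intro δ hδ
      obtain ⟨a, ha, hsa⟩ := hD.dense (max q 2) (hq1.trans (le_max_left _ _))
        (by simp [hq]) s (hsL _) δ hδ
      have ham := hD.measurable a ha
      have hda : s - a ∈ Submodule.span ℝ DΩ :=
        Submodule.sub_mem _ hs (Submodule.subset_span ha)
      have hdm := (hsm.sub ham).aestronglyMeasurable (μ := P)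
      have hq' : eLpNorm (s - a) q P ≤ δ :=
        (eLpNorm_le_eLpNorm_of_exponent_le (le_max_left _ _) hdm).trans hsa.le
      have h2' : eLpNorm (s - a) 2 P ≤ δ :=
        (eLpNorm_le_eLpNorm_of_exponent_le (le_max_right _ _) hdm).trans hsa.le
      have ha1 : ∫⁻ ω, ‖a ω‖ₑ ^ q.toReal ∂P ≤ (N + δ) ^ q.toReal := by
        rw [lintegral_enorm_rpow_eq_eLpNorm_rpow hq0 hq]
        refine ENNReal.rpow_le_rpow ?_ hqr.le
        have : a = s - (s - a) := by simp
        rw [this]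
        exact (eLpNorm_sub_le hsm.aestronglyMeasurable hdm hq1).trans (add_le_add le_rfl hq')
      have ha2 : ∫⁻ ω, ‖(s - a) ω‖ₑ ^ (2 : ℝ) ∂P ≤ δ ^ (2 : ℝ) := by
        have := lintegral_enorm_rpow_eq_eLpNorm_rpow (μ := P) two_ne_zero ENNReal.ofNat_ne_top
          (s - a)
        rw [ENNReal.toReal_ofNat] at this
        rw [this]
        exact ENNReal.rpow_le_rpow h2' zero_le_two
      refine ENNReal.limsup_le_add_of_le
        (g := fun i => ∫⁻ x in K, ‖a (S i x)‖ₑ ^ q.toReal ∂μ)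
        (h := fun i => ENNReal.ofReal η * μ K +
          ENNReal.ofReal C * ∫⁻ x, ‖(s - a) (S i x)‖ₑ ^ (2 : ℝ) ∂μ) (fun i => ?_)
        ((h.limsup_setLIntegral_le_of_mem hD hQm hQd hq1 hq ha hK).trans (by gcongr)) ?_
      · have hae : AEMeasurable (fun x => ‖a (S i x)‖ₑ ^ q.toReal) (μ.restrict K) :=
          ((h.aestronglyMeasurable i a ham).enorm.pow_const _).restrict
        calc ∫⁻ x in K, ‖s (S i x)‖ₑ ^ q.toReal ∂μ
            ≤ ∫⁻ x in K, (‖a (S i x)‖ₑ ^ q.toReal + (ENNReal.ofReal η +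
              ENNReal.ofReal C * ‖(s - a) (S i x)‖ₑ ^ (2 : ℝ))) ∂μ :=
              lintegral_mono fun x => hC _ _ (hM _)
          _ = ∫⁻ x in K, ‖a (S i x)‖ₑ ^ q.toReal ∂μ + (ENNReal.ofReal η * μ K +
              ENNReal.ofReal C * ∫⁻ x in K, ‖(s - a) (S i x)‖ₑ ^ (2 : ℝ) ∂μ) := by
              rw [lintegral_add_left' hae, lintegral_add_left measurable_const,
                setLIntegral_const, lintegral_const_mul' _ _ ENNReal.ofReal_ne_top]
          _ ≤ _ := by
              gcongr
              exact Measure.restrict_le_self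
      · have ht := (ENNReal.Tendsto.const_mul (h.tendsto_sq _ hda)
          (Or.inr (ENNReal.ofReal_ne_top (r := C)))).const_add (ENNReal.ofReal η * μ K)
        rw [ht.limsup_eq]
        gcongr
    have := ENNReal.le_apply_zero_of_forall_pos (F := fun δ => (N + δ) ^ q.toReal * μ K +
      (ENNReal.ofReal η * μ K + ENNReal.ofReal C * (δ ^ (2 : ℝ) * μ Set.univ))) ?_ hδ
    · simpa using this
    · refine Continuous.continuousAt ?_
      refine Continuous.add ?_ (continuous_const.add ?_)
      · exact (ENNReal.continuous_mul_const (measure_ne_top μ K)).comp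
          (ENNReal.continuous_rpow_const.comp (continuous_const.add continuous_id))
      · exact (ENNReal.continuous_const_mul ENNReal.ofReal_ne_top).comp
          ((ENNReal.continuous_mul_const (measure_ne_top μ _)).comp
            ENNReal.continuous_rpow_const)
  rw [lintegral_enorm_rpow_eq_eLpNorm_rpow hq0 hq, ← hN]
  have hlim : Tendsto (fun η : ℝ => N ^ q.toReal * μ K + ENNReal.ofReal η * μ K) (𝓝[>] 0)
      (𝓝 (N ^ q.toReal * μ K + ENNReal.ofReal 0 * μ K)) := by
    refine Tendsto.mono_left ?_ nhdsWithin_le_nhds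
    exact (continuous_const.add ((ENNReal.continuous_mul_const (measure_ne_top μ K)).comp
      ENNReal.continuous_ofReal)).tendsto 0
  simpa using ge_of_tendsto hlim (eventually_mem_nhdsWithin.mono hη)

end IsGenericFamily

theorem sum_mul_mem_span {Ω : Type*} {DΩ : Set (Ω → ℝ)} {κ : Type*} [Fintype κ] {a : κ → Ω → ℝ}
    (ha : ∀ k, a k ∈ Submodule.span ℝ DΩ) (y : κ → ℝ) :
    (fun ω => ∑ k, a k ω * y k) ∈ Submodule.span ℝ DΩ := by
  have : (fun ω => ∑ k, a k ω * y k) = ∑ k, y k • a k := by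
    ext ω
    simp [Finset.sum_apply, mul_comm]
  rw [this]
  exact Submodule.sum_mem _ fun k _ => Submodule.smul_mem _ _ (ha k)

namespace IsGenericFamily

variable {ι Ω X : Type*} [MeasurableSpace Ω] [MeasurableSpace X] {P : Measure Ω}
  [IsProbabilityMeasure P] {μ : Measure X} [IsFiniteMeasure μ] {q : ℝ≥0∞} {DΩ : Set (Ω → ℝ)}
  {DQ : Set (X → ℝ)} {l : Filter ι} [NeBot l] {S : ι → X → Ω}

/-- Sums of products with simple functions of the space variable: such a sum is a linear
combination of test functions of the random variable on each fibre of the simple function. -/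
theorem limsup_eLpNorm_simpleFunc_le (h : IsGenericFamily P μ q DΩ DQ l S)
    (hD : IsRandomTestSet P DΩ) (hQm : ∀ b ∈ DQ, AEStronglyMeasurable b μ)
    (hQd : DenseInLp μ q DQ) (hq1 : 1 ≤ q) (hq : q ≠ ∞) {κ : Type*} [Fintype κ]
    {a : κ → Ω → ℝ} (ha : ∀ k, a k ∈ Submodule.span ℝ DΩ) (β : SimpleFunc X (κ → ℝ)) :
    limsup (fun i => eLpNorm (fun x => ∑ k, a k (S i x) * β x k) q μ) l ≤
      eLpNorm (fun z : Ω × X => ∑ k, a k z.1 * β z.2 k) q (P.prod μ) := by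
  have hq0 : q ≠ 0 := (zero_lt_one.trans_le hq1).ne'
  have hqr := ENNReal.toReal_pos hq0 hq
  have ham : ∀ k, Measurable (a k) := fun k => hD.measurable_of_mem_span (ha k)
  have hβ : ∀ k, Measurable fun x => β x k := fun k => (measurable_pi_apply k).comp β.measurable
  rw [← ENNReal.rpow_le_rpow_iff hqr, ← ENNReal.limsup_rpow _ hqr.le]
  simp only [← lintegral_enorm_rpow_eq_eLpNorm_rpow hq0 hq]
  -- both sides are sums over the fibres
  have hL : ∀ i, ∫⁻ x, ‖∑ k, a k (S i x) * β x k‖ₑ ^ q.toReal ∂μ =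
      ∑ y ∈ β.range, ∫⁻ x in β ⁻¹' {y}, ‖∑ k, a k (S i x) * y k‖ₑ ^ q.toReal ∂μ := by
    intro i
    have hU : (⋃ y ∈ β.range, β ⁻¹' {y}) = Set.univ := by
      ext x
      simp
    rw [← setLIntegral_univ, ← hU, lintegral_biUnion_finset
      (fun y _ z _ hyz => Disjoint.preimage _ (by simpa using hyz))
      (fun y _ => β.measurableSet_preimage _)]
    refine Finset.sum_congr rfl fun y _ =>
      setLIntegral_congr_fun (β.measurableSet_preimage _) fun x hx => ?_
    have : β x = y := hx
    simp only [this]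
  have hR : ∫⁻ z, ‖∑ k, a k z.1 * β z.2 k‖ₑ ^ q.toReal ∂(P.prod μ) =
      ∑ y ∈ β.range, (∫⁻ ω, ‖∑ k, a k ω * y k‖ₑ ^ q.toReal ∂P) * μ (β ⁻¹' {y}) := by
    have hm : Measurable fun z : Ω × X => ‖∑ k, a k z.1 * β z.2 k‖ₑ ^ q.toReal := by
      refine (Measurable.enorm ?_).pow_const _
      exact Finset.measurable_sum _ fun k _ =>
        ((ham k).comp measurable_fst).mul ((hβ k).comp measurable_snd)
    rw [lintegral_prod_symm' _ hm, ← SimpleFunc.map_lintegral,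
      ← SimpleFunc.lintegral_eq_lintegral]
    rfl
  simp only [hL, hR]
  exact ENNReal.limsup_sum_le _ fun y _ => h.limsup_setLIntegral_le_of_mem_span hD hQm hQd hq1 hq
    (sum_mul_mem_span ha y) (β.measurableSet_preimage _)

/-- Along a generic family, sums of products of test functions have at most the expected
asymptotic `L^q` norm. -/
theorem limsup_eLpNorm_sum_le (h : IsGenericFamily P μ q DΩ DQ l S)
    (hD : IsRandomTestSet P DΩ) (hQm : ∀ b ∈ DQ, AEStronglyMeasurable b μ)
    (hQd : DenseInLp μ q DQ) (hq1 : 1 ≤ q) (hq : q ≠ ∞) {κ : Type*} [Fintype κ]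
    {a : κ → Ω → ℝ} (ha : ∀ k, a k ∈ Submodule.span ℝ DΩ) {b : κ → X → ℝ}
    (hb : ∀ k, MemLp (b k) q μ) :
    limsup (fun i => eLpNorm (fun x => ∑ k, a k (S i x) * b k x) q μ) l ≤
      eLpNorm (fun z : Ω × X => ∑ k, a k z.1 * b k z.2) q (P.prod μ) := by
  have ham : ∀ k, Measurable (a k) := fun k => hD.measurable_of_mem_span (ha k)
  choose M hM using fun k => hD.bounded_of_mem_span (ha k)
  set C := ∑ k, M k
  let B : X → κ → ℝ := fun x k => b k x
  have hB : MemLp B q μ := MemLp.of_eval hb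
  have hdiff : ∀ (ω : Ω) (v w : κ → ℝ), ‖∑ k, a k ω * v k - ∑ k, a k ω * w k‖ ≤ C * ‖v - w‖ := by
    intro ω v w
    rw [← Finset.sum_sub_distrib, Finset.sum_mul]
    refine norm_sum_le_of_le _ fun k _ => ?_
    rw [← mul_sub, norm_mul]
    exact mul_le_mul (hM k ω) (norm_le_pi_norm (v - w) k) (norm_nonneg _)
      ((abs_nonneg _).trans (hM k ω))
  have hδ : ∀ δ : ℝ≥0∞, 0 < δ →
      limsup (fun i => eLpNorm (fun x => ∑ k, a k (S i x) * b k x) q μ) l ≤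
        eLpNorm (fun z : Ω × X => ∑ k, a k z.1 * b k z.2) q (P.prod μ) + ENNReal.ofReal C * δ +
          ENNReal.ofReal C * δ := by
    intro δ hδ
    obtain ⟨β, hβ, -⟩ := hB.exists_simpleFunc_eLpNorm_sub_lt hq hδ.ne'
    have hβm : ∀ k, Measurable fun x => β x k := fun k =>
      (measurable_pi_apply k).comp β.measurable
    have hprod : eLpNorm (fun z : Ω × X => ∑ k, a k z.1 * β z.2 k) q (P.prod μ) ≤
        eLpNorm (fun z : Ω × X => ∑ k, a k z.1 * b k z.2) q (P.prod μ) +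
          ENNReal.ofReal C * δ := by
      have hm1 : AEStronglyMeasurable (fun z : Ω × X => ∑ k, a k z.1 * b k z.2) (P.prod μ) :=
        Finset.aestronglyMeasurable_fun_sum _ fun k _ =>
          ((ham k).comp measurable_fst).aestronglyMeasurable.mul (hb k).1.comp_snd
      have hm2 : AEStronglyMeasurable (fun z : Ω × X => ∑ k, a k z.1 * β z.2 k) (P.prod μ) :=
        Finset.aestronglyMeasurable_fun_sum _ fun k _ =>
          (((ham k).comp measurable_fst).mul ((hβm k).comp measurable_snd)).aestronglyMeasurable
      have e : (fun z : Ω × X => ∑ k, a k z.1 * β z.2 k) =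
          (fun z : Ω × X => ∑ k, a k z.1 * b k z.2) -
            ((fun z : Ω × X => ∑ k, a k z.1 * b k z.2) -
              fun z : Ω × X => ∑ k, a k z.1 * β z.2 k) := by simp
      rw [e]
      refine (eLpNorm_sub_le hm1 (hm1.sub hm2) hq1).trans (add_le_add le_rfl ?_)
      refine (eLpNorm_le_mul_eLpNorm_of_ae_le_mul (g := fun z : Ω × X => (B - ⇑β) z.2) (c := C)
        (ae_of_all _ fun z => hdiff z.1 (B z.2) (β z.2)) q).trans (mul_le_mul_right ?_ _)
      have := eLpNorm_comp_measurePreserving (p := q)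
        (hB.1.sub β.aestronglyMeasurable) (measurePreserving_snd (μ := P) (ν := μ))
      exact this.trans_le hβ.le
    refine ENNReal.limsup_le_add_of_le
      (g := fun i => eLpNorm (fun x => ∑ k, a k (S i x) * β x k) q μ)
      (h := fun i => eLpNorm ((fun x => ∑ k, a k (S i x) * b k x) -
        fun x => ∑ k, a k (S i x) * β x k) q μ) (fun i => ?_)
      ((h.limsup_eLpNorm_simpleFunc_le hD hQm hQd hq1 hq ha β).trans hprod)
      (limsup_le_of_le (by isBoundedDefault) (Eventually.of_forall fun i => ?_))
    · have hm := fun k => h.aestronglyMeasurable i (a k) (ham k)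
      have hm1 : AEStronglyMeasurable (fun x => ∑ k, a k (S i x) * b k x) μ :=
        Finset.aestronglyMeasurable_fun_sum _ fun k _ => (hm k).mul (hb k).1
      have hm2 : AEStronglyMeasurable (fun x => ∑ k, a k (S i x) * β x k) μ :=
        Finset.aestronglyMeasurable_fun_sum _ fun k _ =>
          (hm k).mul (hβm k).aestronglyMeasurable
      have e : (fun x => ∑ k, a k (S i x) * b k x) = (fun x => ∑ k, a k (S i x) * β x k) +
          ((fun x => ∑ k, a k (S i x) * b k x) - fun x => ∑ k, a k (S i x) * β x k) := by simp
      conv_lhs => rw [e]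
      exact eLpNorm_add_le hm2 (hm1.sub hm2) hq1
    · exact (eLpNorm_le_mul_eLpNorm_of_ae_le_mul (g := B - ⇑β) (c := C)
        (ae_of_all _ fun x => hdiff (S i x) (B x) (β x)) q).trans (mul_le_mul_right hβ.le _)
  have := ENNReal.le_apply_zero_of_forall_pos (F := fun δ =>
    eLpNorm (fun z : Ω × X => ∑ k, a k z.1 * b k z.2) q (P.prod μ) + ENNReal.ofReal C * δ +
      ENNReal.ofReal C * δ) ?_ hδ
  · simpa using this
  · have hc := ENNReal.continuous_const_mul (a := ENNReal.ofReal C) ENNReal.ofReal_ne_top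
    exact ((continuous_const.add hc).add hc).continuousAt

end IsGenericFamily

/-! ### Linear functionals: subsequences, extension, pairings -/

/-- A sequence of linear functionals that is bounded on each element of a countable generating set
has a subsequence that converges pointwise. -/
theorem exists_subseq_tendsto_linearMap {V : Type*} [AddCommGroup V] [Module ℝ V] {A : Set V}
    (hA : A.Countable) (F : ℕ → Submodule.span ℝ A →ₗ[ℝ] ℝ)
    (hF : ∀ φ (hφ : φ ∈ A), ∃ C : ℝ, ∀ n, |F n ⟨φ, Submodule.subset_span hφ⟩| ≤ C) :
    ∃ (k : ℕ → ℕ) (L : Submodule.span ℝ A →ₗ[ℝ] ℝ), StrictMono k ∧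
      ∀ φ, Tendsto (fun n => F (k n) φ) atTop (𝓝 (L φ)) := by
  have : Countable A := hA
  choose C hC using fun φ : A => hF φ φ.2
  obtain ⟨c₀, -, k, hk, hlim⟩ :=
    (isCompact_univ_pi fun φ : A => isCompact_Icc (a := -C φ) (b := C φ)).tendsto_subseq
      (x := fun n (φ : A) => F n ⟨φ, Submodule.subset_span φ.2⟩)
      fun n φ _ => abs_le.1 (hC φ n)
  have hex : ∀ φ : Submodule.span ℝ A, ∃ c, Tendsto (fun n => F (k n) φ) atTop (𝓝 c) := by
    rintro ⟨φ, hφ⟩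
    induction hφ using Submodule.span_induction with
    | mem φ hφ => exact ⟨_, tendsto_pi_nhds.1 hlim ⟨φ, hφ⟩⟩
    | zero => exact ⟨0, tendsto_const_nhds.congr fun n => (map_zero (F (k n))).symm⟩
    | add φ ψ hφ hψ h1 h2 =>
      obtain ⟨c, hc⟩ := h1
      obtain ⟨d, hd⟩ := h2
      exact ⟨c + d, (hc.add hd).congr fun n => (map_add (F (k n)) ⟨φ, hφ⟩ ⟨ψ, hψ⟩).symm⟩
    | smul r φ hφ h1 =>
      obtain ⟨c, hc⟩ := h1
      exact ⟨r • c, (hc.const_smul r).congr fun n => (map_smul (F (k n)) r ⟨φ, hφ⟩).symm⟩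
  choose L hL using hex
  exact ⟨k, linearMapOfTendsto L (fun n => F (k n)) (tendsto_pi_nhds.2 hL), hk, hL⟩

/-- **Hahn–Banach** for a functional on a vector space `V` that is dominated by a seminorm
`φ ↦ ‖T φ‖`. -/
theorem exists_strongDual_of_le_norm {V E : Type*} [AddCommGroup V] [Module ℝ V]
    [NormedAddCommGroup E] [NormedSpace ℝ E] (T : V →ₗ[ℝ] E) (L : V →ₗ[ℝ] ℝ) {M : ℝ} (hM : 0 ≤ M)
    (h : ∀ φ, |L φ| ≤ M * ‖T φ‖) :
    ∃ Λ : StrongDual ℝ E, ‖Λ‖ ≤ M ∧ ∀ φ, Λ (T φ) = L φ := by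
  obtain ⟨σ, hσ⟩ := T.rangeRestrict.exists_rightInverse_of_surjective T.range_rangeRestrict
  have hσ' : ∀ y : LinearMap.range T, T (σ y) = y := fun y =>
    congrArg Subtype.val (LinearMap.congr_fun hσ y)
  have hbound : ∀ y : LinearMap.range T, ‖(L ∘ₗ σ) y‖ ≤ M * ‖y‖ := fun y => by
    have := h (σ y)
    rw [hσ'] at this
    exact this
  obtain ⟨Λ, hΛ, hn⟩ := exists_extension_norm_eq (𝕜 := ℝ) (LinearMap.range T)
    ((L ∘ₗ σ).mkContinuous M hbound)
  refine ⟨Λ, hn.trans_le (LinearMap.mkContinuous_norm_le _ hM _), fun φ => ?_⟩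
  have h1 := hΛ ⟨T φ, LinearMap.mem_range_self T φ⟩
  have h2 := h (σ ⟨T φ, LinearMap.mem_range_self T φ⟩ - φ)
  rw [map_sub T, hσ', sub_self, norm_zero, mul_zero, map_sub] at h2
  exact h1.trans (sub_eq_zero.1 (abs_nonpos_iff.1 h2))

theorem abs_integral_mul_le_eLpNorm {α : Type*} [MeasurableSpace α] {μ : Measure α} {p q : ℝ≥0∞}
    [ENNReal.HolderConjugate p q] {f g : α → ℝ} (hf : MemLp f p μ) (hg : MemLp g q μ) :
    |∫ x, f x * g x ∂μ| ≤ (eLpNorm f p μ).toReal * (eLpNorm g q μ).toReal := by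
  have h1 : eLpNorm (f • g) 1 μ ≤ eLpNorm f p μ * eLpNorm g q μ :=
    eLpNorm_smul_le_mul_eLpNorm hg.1 hf.1
  rw [← ENNReal.toReal_mul]
  refine le_trans ?_ (ENNReal.toReal_mono (ENNReal.mul_ne_top hf.2.ne hg.2.ne) h1)
  have h2 := norm_integral_le_lintegral_norm (μ := μ) (f • g)
  rw [eLpNorm_one_eq_lintegral_enorm]
  simpa [Real.enorm_eq_ofReal_abs] using h2

theorem abs_integral_Lp_mul_le {α : Type*} [MeasurableSpace α] {μ : Measure α} {p q : ℝ≥0∞}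
    [ENNReal.HolderConjugate p q] (f : Lp ℝ p μ) {g : α → ℝ} (hg : MemLp g q μ) :
    |∫ x, f x * g x ∂μ| ≤ ‖f‖ * (eLpNorm g q μ).toReal :=
  abs_integral_mul_le_eLpNorm (Lp.memLp f) hg

/-! ### Test functions along an orbit -/

/-- The realizations of a random variable along an orbit of the flow, at scale `ε`, are measurable
up to null sets. -/
theorem IsMeasurePreservingFlow.aestronglyMeasurable_orbit {d : ℕ} {Ω : Type*} [MeasurableSpace Ω]
    {P : Measure Ω} {τ : PhysSpace d → Ω → Ω} (hτ : IsMeasurePreservingFlow P τ) (ω₀ : Ω) {ε : ℝ}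
    (hε : 0 < ε) {a : Ω → ℝ} (ha : Measurable a) :
    AEStronglyMeasurable (fun x => a (τ (ε⁻¹ • x) ω₀)) (volume : Measure (PhysSpace d)) := by
  have h1 : NullMeasurable (fun x : PhysSpace d => a (τ x ω₀)) volume :=
    ha.comp (hτ.measurable_joint.comp
      (measurable_prodMk_left (x := ω₀) (β := NullMeasurableSpace (PhysSpace d) volume)))
  have h2 : AEMeasurable (fun x : PhysSpace d => a (τ x ω₀)) volume := h1.aemeasurable
  have hm : Measurable fun x : PhysSpace d => ε⁻¹ • x := measurable_const_smul _
  refine (h2.comp_quasiMeasurePreserving ⟨hm, ?_⟩).aestronglyMeasurable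
  rw [Measure.map_addHaar_smul volume (inv_ne_zero hε.ne')]
  exact Measure.smul_absolutelyContinuous

section Spatial

variable {d : ℕ} {Q : Set (PhysSpace d)} {DQ : Set (PhysSpace d → ℝ)}

theorem IsSpatialTestSet.memLp (hDQ : IsSpatialTestSet Q DQ) (hQo : IsOpen Q)
    (hQb : Bornology.IsBounded Q) {b : PhysSpace d → ℝ} (hb : b ∈ DQ) (r : ℝ≥0∞) :
    MemLp b r (volume.restrict Q) := by
  have : IsFiniteMeasure (volume.restrict Q) := ⟨by simpa using hQb.measure_lt_top⟩
  have hc : IsCompact (closure Q) := Metric.isCompact_of_isClosed_isBounded isClosed_closure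
    hQb.closure
  obtain ⟨C, hC⟩ := hc.exists_bound_of_continuousOn (hDQ.continuousOn b hb)
  refine MemLp.of_bound (((hDQ.continuousOn b hb).mono subset_closure).aestronglyMeasurable
    hQo.measurableSet) C ?_
  exact (ae_restrict_iff' hQo.measurableSet).2
    (ae_of_all _ fun x hx => hC x (subset_closure hx))

end Spatial

/-- An element of the test space is a finite sum of products of a linear combination of random
test functions and a spatial test function. -/
theorem exists_sum_of_mem_testSpace {d : ℕ} {Ω : Type*} {DΩ : Set (Ω → ℝ)}
    {DQ : Set (PhysSpace d → ℝ)} {φ : Ω × PhysSpace d → ℝ} (hφ : φ ∈ testSpace DΩ DQ) :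
    ∃ (n : ℕ) (a : Fin n → Ω → ℝ) (b : Fin n → PhysSpace d → ℝ),
      (∀ k, a k ∈ Submodule.span ℝ DΩ) ∧ (∀ k, b k ∈ DQ) ∧
        φ = fun z => ∑ k, a k z.1 * b k z.2 := by
  obtain ⟨n, c, g, rfl⟩ := Submodule.mem_span_set'.1 hφ
  choose a ha b hb hab using fun k => (g k).2
  refine ⟨n, fun k => c k • a k, b,
    fun k => Submodule.smul_mem _ _ (Submodule.subset_span (ha k)), hb, ?_⟩
  ext z
  simp [Finset.sum_apply, hab, mul_assoc]

section Orbit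

variable {d : ℕ} {Ω : Type*} [MeasurableSpace Ω] {P : Measure Ω}
  {τ : PhysSpace d → Ω → Ω} {p q : ℝ≥0∞} {Q : Set (PhysSpace d)} {DΩ : Set (Ω → ℝ)}
  {DQ : Set (PhysSpace d → ℝ)} {ω₀ : Ω} {ε : ℕ → ℝ}

theorem memLp_unfoldAdj (hτ : IsMeasurePreservingFlow P τ) (hDΩ : IsRandomTestSet P DΩ)
    (hDQ : IsSpatialTestSet Q DQ) (hQo : IsOpen Q) (hQb : Bornology.IsBounded Q) (ω₀ : Ω) {ε : ℝ}
    (hε : 0 < ε) (r : ℝ≥0∞) {φ : Ω × PhysSpace d → ℝ} (hφ : φ ∈ testSpace DΩ DQ) :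
    MemLp (unfoldAdj τ ε φ ω₀) r (volume.restrict Q) := by
  obtain ⟨n, a, b, ha, hb, rfl⟩ := exists_sum_of_mem_testSpace hφ
  refine memLp_finsetSum Finset.univ fun k _ => ?_
  obtain ⟨C, hC⟩ := hDΩ.bounded_of_mem_span (ha k)
  exact (hDQ.memLp hQo hQb (hb k) r).of_le_mul (c := C)
    ((hτ.aestronglyMeasurable_orbit ω₀ hε (hDΩ.measurable_of_mem_span (ha k))).restrict.mul
      (hDQ.memLp hQo hQb (hb k) r).1)
    (ae_of_all _ fun x => by
      rw [norm_mul]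
      exact mul_le_mul_of_nonneg_right (hC _) (norm_nonneg _))

theorem memLp_of_mem_testSpace [IsProbabilityMeasure P] (hDΩ : IsRandomTestSet P DΩ)
    (hDQ : IsSpatialTestSet Q DQ) (hQo : IsOpen Q) (hQb : Bornology.IsBounded Q) (r : ℝ≥0∞)
    {φ : Ω × PhysSpace d → ℝ} (hφ : φ ∈ testSpace DΩ DQ) :
    MemLp φ r (cylMeasure P Q) := by
  obtain ⟨n, a, b, ha, hb, rfl⟩ := exists_sum_of_mem_testSpace hφ
  refine memLp_finsetSum Finset.univ fun k _ => ?_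
  obtain ⟨C, hC⟩ := hDΩ.bounded_of_mem_span (ha k)
  have hbk := (hDQ.memLp hQo hQb (hb k) r).comp_snd P
  exact hbk.of_le_mul (c := C)
    (((hDΩ.measurable_of_mem_span (ha k)).comp measurable_fst).aestronglyMeasurable.mul hbk.1)
    (ae_of_all _ fun x => by
      rw [norm_mul]
      exact mul_le_mul_of_nonneg_right (hC _) (norm_nonneg _))

/-- Along the orbit of an admissible realization, the correlations of linear combinations of
random test functions converge, by bilinearity. -/
theorem tendsto_integral_mul_orbit [IsProbabilityMeasure P] (hτ : IsMeasurePreservingFlow P τ)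
    (hDΩ : IsRandomTestSet P DΩ) (hDQ : IsSpatialTestSet Q DQ) (hQb : Bornology.IsBounded Q)
    (hω₀ : ω₀ ∈ admissibleSet P τ p q Q DΩ DQ) (hε : ∀ n, 0 < ε n)
    (hεl : Tendsto ε atTop (𝓝 0)) {s t : Ω → ℝ} (hs : s ∈ Submodule.span ℝ DΩ)
    (ht : t ∈ Submodule.span ℝ DΩ) :
    Tendsto (fun n => ∫ x in Q, s (τ ((ε n)⁻¹ • x) ω₀) * t (τ ((ε n)⁻¹ • x) ω₀)) atTop
      (𝓝 ((∫ ω, s ω * t ω ∂P) * volume.real Q)) := by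
  have : IsFiniteMeasure (volume.restrict Q) := ⟨by simpa using hQb.measure_lt_top⟩
  have hεl' : Tendsto ε atTop (𝓝[>] 0) :=
    tendsto_nhdsWithin_iff.2 ⟨hεl, Eventually.of_forall hε⟩
  have hL : ∀ s ∈ Submodule.span ℝ DΩ, MemLp s 2 P := fun s hs => by
    obtain ⟨C, hC⟩ := hDΩ.bounded_of_mem_span hs
    exact MemLp.of_bound (hDΩ.measurable_of_mem_span hs).aestronglyMeasurable C (ae_of_all _ hC)
  have hLn : ∀ s ∈ Submodule.span ℝ DΩ, ∀ n,
      MemLp (fun x => s (τ ((ε n)⁻¹ • x) ω₀)) 2 (volume.restrict Q) := fun s hs n => by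
    obtain ⟨C, hC⟩ := hDΩ.bounded_of_mem_span hs
    exact MemLp.of_bound (hτ.aestronglyMeasurable_orbit ω₀ (hε n)
      (hDΩ.measurable_of_mem_span hs)).restrict C (ae_of_all _ fun x => hC _)
  have hI : ∀ s ∈ Submodule.span ℝ DΩ, ∀ t ∈ Submodule.span ℝ DΩ,
      Integrable (fun ω => s ω * t ω) P := fun s hs t ht => (hL s hs).integrable_mul (hL t ht)
  have hIn : ∀ s ∈ Submodule.span ℝ DΩ, ∀ t ∈ Submodule.span ℝ DΩ, ∀ n,
      Integrable (fun x => s (τ ((ε n)⁻¹ • x) ω₀) * t (τ ((ε n)⁻¹ • x) ω₀))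
        (volume.restrict Q) := fun s hs t ht n => (hLn s hs n).integrable_mul (hLn t ht n)
  induction hs, ht using Submodule.span_induction₂ with
  | mem_mem a a' ha ha' =>
    have h := (hω₀.2 (fun z => a z.1 * 1) ⟨a, ha, _, hDQ.one_mem, rfl⟩
      (fun z => a' z.1 * 1) ⟨a', ha', _, hDQ.one_mem, rfl⟩).comp hεl'
    have e : ∫ z : Ω × PhysSpace d, a z.1 * 1 * (a' z.1 * 1) ∂(cylMeasure P Q) =
        (∫ ω, a ω * a' ω ∂P) * volume.real Q := by
      have := integral_prod_mul (μ := P) (ν := volume.restrict Q) (fun ω => a ω * a' ω)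
        (fun _ : PhysSpace d => (1 : ℝ))
      simpa [Measure.real] using this
    rw [e] at h
    refine h.congr fun n => ?_
    simp [unfoldAdj]
  | zero_left t ht => simp
  | zero_right s hs => simp
  | add_left s s' t hs hs' ht h1 h2 =>
    simp only [Pi.add_apply, add_mul]
    rw [integral_add (hI s hs t ht) (hI s' hs' t ht), add_mul]
    refine (h1.add h2).congr fun n => ?_
    rw [integral_add (hIn s hs t ht n) (hIn s' hs' t ht n)]
  | add_right s t t' hs ht ht' h1 h2 =>
    simp only [Pi.add_apply, mul_add]
    rw [integral_add (hI s hs t ht) (hI s hs t' ht'), add_mul]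
    refine (h1.add h2).congr fun n => ?_
    rw [integral_add (hIn s hs t ht n) (hIn s hs t' ht' n)]
  | smul_left r s t hs ht h1 =>
    simp only [Pi.smul_apply, smul_eq_mul, mul_assoc, integral_const_mul]
    simp only [← mul_assoc] at h1 ⊢
    simpa [mul_assoc] using h1.const_mul r
  | smul_right r s t hs ht h1 =>
    simp only [Pi.smul_apply, smul_eq_mul, mul_left_comm, integral_const_mul]
    simpa [mul_assoc] using h1.const_mul r

/-- The orbit of an admissible realization is a generic family as the scale tends to `0`. -/
theorem isGenericFamily_orbit [IsProbabilityMeasure P] (hτ : IsMeasurePreservingFlow P τ)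
    (hDΩ : IsRandomTestSet P DΩ) (hDQ : IsSpatialTestSet Q DQ) (hQo : IsOpen Q)
    (hQb : Bornology.IsBounded Q) (hq0 : q ≠ 0) (hq : q ≠ ∞)
    (hω₀ : ω₀ ∈ admissibleSet P τ p q Q DΩ DQ) (hε : ∀ n, 0 < ε n)
    (hεl : Tendsto ε atTop (𝓝 0)) :
    IsGenericFamily P (volume.restrict Q) q DΩ DQ atTop
      (fun n x => τ ((ε n)⁻¹ • x) ω₀) where
  aestronglyMeasurable n a ha := (hτ.aestronglyMeasurable_orbit ω₀ (hε n) ha).restrict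
  limsup_le a ha b hb := by
    have hεl' : Tendsto ε atTop (𝓝[>] 0) :=
      tendsto_nhdsWithin_iff.2 ⟨hεl, Eventually.of_forall hε⟩
    rw [← eLpNorm_prod_mul hq0 hq (hDΩ.measurable a ha).aemeasurable
      (hDQ.memLp hQo hQb hb 1).1.aemeasurable]
    have h := hω₀.1 (fun z => a z.1 * b z.2) ⟨a, ha, b, hb, rfl⟩ q (Or.inr rfl)
    let N : ℝ → ℝ≥0∞ := fun ε =>
      eLpNorm (unfoldAdj τ ε (fun z => a z.1 * b z.2) ω₀) q (volume.restrict Q)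
    have h2 : limsup (N ∘ ε) atTop ≤ limsup N (𝓝[>] 0) := by
      rw [limsup_comp]
      exact limsup_le_limsup_of_le hεl'
    exact h2.trans h
  tendsto_sq s hs := by
    have : IsFiniteMeasure (volume.restrict Q) := ⟨by simpa using hQb.measure_lt_top⟩
    have hm := hDΩ.measurable_of_mem_span hs
    obtain ⟨C, hC⟩ := hDΩ.bounded_of_mem_span hs
    have hlim := (ENNReal.continuous_ofReal.tendsto _).comp
      (tendsto_integral_mul_orbit hτ hDΩ hDQ hQb hω₀ hε hεl hs hs)
    rw [lintegral_enorm_sq_eq_ofReal hm.aestronglyMeasurable hC, Measure.restrict_apply_univ]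
    rw [ENNReal.ofReal_mul (integral_nonneg fun x => mul_self_nonneg _), Measure.real,
      ENNReal.ofReal_toReal hQb.measure_lt_top.ne] at hlim
    refine hlim.congr fun n => ?_
    exact (lintegral_enorm_sq_eq_ofReal
      (hτ.aestronglyMeasurable_orbit ω₀ (hε n) hm).restrict fun x => hC _).symm

end Orbit

section Compactness

variable {d : ℕ} {Ω : Type*} [MeasurableSpace Ω] {P : Measure Ω}
  {τ : PhysSpace d → Ω → Ω} {p q : ℝ≥0∞} {Q : Set (PhysSpace d)} {DΩ : Set (Ω → ℝ)}
  {DQ : Set (PhysSpace d → ℝ)} {ω₀ : Ω} {ε : ℕ → ℝ}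

/-- For an admissible realization, the bound on the asymptotic `L^q` norms extends from `𝒜` to its
span. -/
theorem limsup_eLpNorm_unfoldAdj_le [IsProbabilityMeasure P] (hτ : IsMeasurePreservingFlow P τ)
    (hDΩ : IsRandomTestSet P DΩ) (hDQ : IsSpatialTestSet Q DQ) (hQo : IsOpen Q)
    (hQb : Bornology.IsBounded Q) (hq1 : 1 ≤ q) (hq : q ≠ ∞)
    (hω₀ : ω₀ ∈ admissibleSet P τ p q Q DΩ DQ) (hε : ∀ n, 0 < ε n)
    (hεl : Tendsto ε atTop (𝓝 0)) {φ : Ω × PhysSpace d → ℝ} (hφ : φ ∈ testSpace DΩ DQ) :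
    limsup (fun n => eLpNorm (unfoldAdj τ (ε n) φ ω₀) q (volume.restrict Q)) atTop ≤
      eLpNorm φ q (cylMeasure P Q) := by
  have : IsFiniteMeasure (volume.restrict Q) := ⟨by simpa using hQb.measure_lt_top⟩
  obtain ⟨n, a, b, ha, hb, rfl⟩ := exists_sum_of_mem_testSpace hφ
  exact (isGenericFamily_orbit hτ hDΩ hDQ hQo hQb (zero_lt_one.trans_le hq1).ne' hq hω₀ hε
    hεl).limsup_eLpNorm_sum_le hDΩ (fun b hb => (hDQ.memLp hQo hQb hb 1).1) (hDQ.dense q hq1 hq)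
      hq1 hq ha fun k => hDQ.memLp hQo hQb (hb k) q

/-- The testing of `w ∈ L^p(Q)` against the oscillating test functions, as a linear functional on
the test space. -/
theorem exists_linearMap_integral_unfoldAdj [Fact (1 ≤ p)] [ENNReal.HolderConjugate p q]
    (hτ : IsMeasurePreservingFlow P τ) (hDΩ : IsRandomTestSet P DΩ) (hDQ : IsSpatialTestSet Q DQ)
    (hQo : IsOpen Q) (hQb : Bornology.IsBounded Q) (ω₀ : Ω) {ε : ℝ} (hε : 0 < ε)
    (w : Lp ℝ p (volume.restrict Q)) :
    ∃ F : testSpace DΩ DQ →ₗ[ℝ] ℝ, ∀ φ : testSpace DΩ DQ,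
      F φ = ∫ x in Q, w x * unfoldAdj τ ε φ ω₀ x := by
  have hi : ∀ φ : testSpace DΩ DQ,
      Integrable (fun x => w x * unfoldAdj τ ε φ ω₀ x) (volume.restrict Q) := fun φ =>
    (Lp.memLp w).integrable_mul (memLp_unfoldAdj hτ hDΩ hDQ hQo hQb ω₀ hε q φ.2)
  refine ⟨{ toFun := fun φ => ∫ x in Q, w x * unfoldAdj τ ε φ ω₀ x
            map_add' := fun φ ψ => ?_
            map_smul' := fun c φ => ?_ }, fun φ => rfl⟩
  · rw [← integral_add (hi φ) (hi ψ)]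
    simp [unfoldAdj, mul_add]
  · rw [RingHom.id_apply, smul_eq_mul, ← integral_const_mul]
    simp [unfoldAdj, mul_left_comm]

/-- Compactness for sequences whose norms converge. The limit functional on the test space is
dominated by the limit of the norms times the `L^q` norm on `Ω × Q`, hence it is the pairing with
an element of `L^p`. -/
theorem exists_quenchedTwoScale_subseq [IsProbabilityMeasure P] [Fact (1 ≤ p)] [Fact (1 ≤ q)]
    [ENNReal.HolderConjugate p q] (hp : p ≠ ∞) (hq : q ≠ ∞)
    (hτ : IsMeasurePreservingFlow P τ) (hDΩ : IsRandomTestSet P DΩ) (hDQ : IsSpatialTestSet Q DQ)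
    (hQo : IsOpen Q) (hQb : Bornology.IsBounded Q)
    (hω₀ : ω₀ ∈ admissibleSet P τ p q Q DΩ DQ) (hε : ∀ n, 0 < ε n)
    (hεl : Tendsto ε atTop (𝓝 0)) {u : ℕ → Lp ℝ p (volume.restrict Q)} {C m : ℝ}
    (hu : ∀ n, ‖u n‖ ≤ C) (hm : Tendsto (fun n => ‖u n‖) atTop (𝓝 m)) :
    ∃ (k : ℕ → ℕ) (v : Lp ℝ p (cylMeasure P Q)), StrictMono k ∧
      QuenchedTwoScale P τ Q DΩ DQ ω₀ (fun n => ε (k n)) (fun n => u (k n)) v ∧ ‖v‖ ≤ m := by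
  have : IsFiniteMeasure (volume.restrict Q) := ⟨by simpa using hQb.measure_lt_top⟩
  have hq1 : 1 ≤ q := Fact.out
  have hm0 : 0 ≤ m := ge_of_tendsto' hm fun n => norm_nonneg _
  have hC0 : 0 ≤ C := (norm_nonneg _).trans (hu 0)
  have hmemn : ∀ n, ∀ φ ∈ testSpace DΩ DQ,
      MemLp (unfoldAdj τ (ε n) φ ω₀) q (volume.restrict Q) := fun n φ hφ =>
    memLp_unfoldAdj hτ hDΩ hDQ hQo hQb ω₀ (hε n) q hφ
  have hmem : ∀ φ ∈ testSpace DΩ DQ, MemLp φ q (cylMeasure P Q) := fun φ hφ =>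
    memLp_of_mem_testSpace hDΩ hDQ hQo hQb q hφ
  choose F hF using fun n => exists_linearMap_integral_unfoldAdj (p := p) (q := q) hτ hDΩ hDQ
    hQo hQb ω₀ (hε n) (u n)
  have hFle : ∀ n φ, |F n φ| ≤
      ‖u n‖ * (eLpNorm (unfoldAdj τ (ε n) φ ω₀) q (volume.restrict Q)).toReal := fun n φ => by
    rw [hF]
    exact abs_integral_Lp_mul_le (u n) (hmemn n φ φ.2)
  have hcount : (simpleTensors DΩ DQ).Countable := by
    refine ((hDΩ.countable.prod hDQ.countable).image
      fun ab : (Ω → ℝ) × (PhysSpace d → ℝ) => fun z => ab.1 z.1 * ab.2 z.2).mono ?_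
    rintro φ ⟨a, ha, b, hb, rfl⟩
    exact ⟨(a, b), ⟨ha, hb⟩, rfl⟩
  obtain ⟨k, L, hk, hL⟩ : ∃ (k : ℕ → ℕ) (L : testSpace DΩ DQ →ₗ[ℝ] ℝ), StrictMono k ∧
      ∀ φ, Tendsto (fun n => F (k n) φ) atTop (𝓝 (L φ)) := by
    refine exists_subseq_tendsto_linearMap hcount F ?_
    rintro φ ⟨a, ha, b, hb, rfl⟩
    obtain ⟨A, hA⟩ := hDΩ.bounded a ha
    have hbq := hDQ.memLp hQo hQb hb q
    refine ⟨C * (ENNReal.ofReal A * eLpNorm b q (volume.restrict Q)).toReal, fun n => ?_⟩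
    refine (hFle n _).trans (mul_le_mul (hu n) (ENNReal.toReal_mono
      (ENNReal.mul_ne_top ENNReal.ofReal_ne_top hbq.2.ne) ?_) ENNReal.toReal_nonneg hC0)
    refine eLpNorm_le_mul_eLpNorm_of_ae_le_mul (ae_of_all _ fun x => ?_) q
    rw [unfoldAdj, norm_mul]
    exact mul_le_mul_of_nonneg_right (hA _) (norm_nonneg _)
  have hLle : ∀ φ : testSpace DΩ DQ,
      |L φ| ≤ m * (eLpNorm φ.1 q (cylMeasure P Q)).toReal := by
    intro φ
    have hfin := (hmem φ φ.2).2.ne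
    have hlt : ∀ c : ℝ, (eLpNorm φ.1 q (cylMeasure P Q)).toReal < c → |L φ| ≤ m * c := by
      intro c hc
      have hev := (hk.tendsto_atTop).eventually (eventually_lt_of_limsup_lt
        ((limsup_eLpNorm_unfoldAdj_le hτ hDΩ hDQ hQo hQb hq1 hq hω₀ hε hεl φ.2).trans_lt
          ((ENNReal.lt_ofReal_iff_toReal_lt hfin).2 hc)))
      refine le_of_tendsto_of_tendsto (hL φ).abs
        ((hm.comp hk.tendsto_atTop).mul_const c) ?_
      filter_upwards [hev] with n hn
      refine (hFle _ _).trans (mul_le_mul_of_nonneg_left ?_ (norm_nonneg _))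
      exact ENNReal.toReal_le_of_le_ofReal (ENNReal.toReal_nonneg.trans hc.le) hn.le
    have hlim : Tendsto (fun c : ℝ => m * c)
        (𝓝[>] (eLpNorm φ.1 q (cylMeasure P Q)).toReal)
        (𝓝 (m * (eLpNorm φ.1 q (cylMeasure P Q)).toReal)) :=
      ((continuous_const_mul m).tendsto _).mono_left nhdsWithin_le_nhds
    exact ge_of_tendsto hlim (eventually_mem_nhdsWithin.mono hlt)
  let T : testSpace DΩ DQ →ₗ[ℝ] Lp ℝ q (cylMeasure P Q) :=
    { toFun := fun φ => (hmem φ φ.2).toLp φ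
      map_add' := fun φ ψ => MemLp.toLp_add (hmem φ φ.2) (hmem ψ ψ.2)
      map_smul' := fun c φ => MemLp.toLp_const_smul c (hmem φ φ.2) }
  obtain ⟨Λ, hΛ, hΛT⟩ := exists_strongDual_of_le_norm T L hm0 fun φ => by
    have : ‖T φ‖ = (eLpNorm φ.1 q (cylMeasure P Q)).toReal := Lp.norm_toLp φ.1 (hmem φ.1 φ.2)
    rw [this]
    exact hLle φ
  obtain ⟨v, hv, hvΛ⟩ := exists_Lp_dual_repr (p := p) (cylMeasure P Q) hp hq Λ
  refine ⟨k, v, hk, ⟨⟨C, fun n => hu _⟩, fun φ hφ => ?_⟩, hv.trans hΛ⟩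
  have h1 : L ⟨φ, hφ⟩ = ∫ z, v z * φ z ∂(cylMeasure P Q) := by
    refine (hΛT ⟨φ, hφ⟩).symm.trans ((hvΛ _).trans ?_)
    refine integral_congr_ae ?_
    filter_upwards [(hmem φ hφ).coeFn_toLp] with z hz
    exact congrArg (v z * ·) hz
  rw [← h1]
  exact (hL ⟨φ, hφ⟩).congr fun n => hF _ _

/-! ### The expectation of a two-scale limit -/

theorem memLp_expectation [IsProbabilityMeasure P] (hp1 : 1 ≤ p) (hp : p ≠ ∞)
    [SFinite (volume.restrict Q)]
    (v : Lp ℝ p (cylMeasure P Q)) : MemLp (expectation P v) p (volume.restrict Q) := by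
  have hp0 : p ≠ 0 := (zero_lt_one.trans_le hp1).ne'
  have hsm : StronglyMeasurable (v : Ω × PhysSpace d → ℝ) := Lp.stronglyMeasurable v
  refine ⟨hsm.integral_prod_left'.aestronglyMeasurable, ?_⟩
  rw [eLpNorm_lt_top_iff_lintegral_rpow_enorm_lt_top hp0 hp]
  have hv := (eLpNorm_lt_top_iff_lintegral_rpow_enorm_lt_top hp0 hp).1 (Lp.memLp v).2
  rw [lintegral_prod_symm' _ (hsm.measurable.enorm.pow_const _)] at hv
  refine (lintegral_mono fun x => ?_).trans_lt hv
  have hx : AEStronglyMeasurable (fun ω => v (ω, x)) P :=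
    (hsm.comp_measurable measurable_prodMk_right).aestronglyMeasurable
  rw [lintegral_enorm_rpow_eq_eLpNorm_rpow hp0 hp]
  refine ENNReal.rpow_le_rpow ?_ ENNReal.toReal_nonneg
  refine (enorm_integral_le_lintegral_enorm _).trans ?_
  rw [← eLpNorm_one_eq_lintegral_enorm]
  exact eLpNorm_le_eLpNorm_of_exponent_le hp1 hx

theorem integral_expectation_mul [IsProbabilityMeasure P] [ENNReal.HolderConjugate p q]
    [IsFiniteMeasure (volume.restrict Q)] (v : Lp ℝ p (cylMeasure P Q)) {b : PhysSpace d → ℝ}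
    (hb : MemLp b q (volume.restrict Q)) :
    ∫ x in Q, expectation P v x * b x = ∫ z, v z * b z.2 ∂(cylMeasure P Q) := by
  have hi : Integrable (fun z : Ω × PhysSpace d => v z * b z.2) (cylMeasure P Q) :=
    (Lp.memLp v).integrable_mul (hb.comp_snd P)
  rw [integral_prod_symm _ hi]
  refine integral_congr_ae (ae_of_all _ fun x => ?_)
  exact (integral_mul_const (b x) fun ω => v (ω, x)).symm

end Compactness

/-- In `L^p` of a finite measure, a bounded sequence converges weakly if it converges when tested
against a dense subset of `L^q`. -/
theorem tendsto_toWeakSpace_of_dense {α : Type*} [MeasurableSpace α] {μ : Measure α}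
    [IsFiniteMeasure μ] {p q : ℝ≥0∞} [Fact (1 ≤ p)] [Fact (1 ≤ q)] [ENNReal.HolderConjugate p q]
    (hp : p ≠ ∞) (hq : q ≠ ∞) {D : Set (α → ℝ)} (hD : DenseInLp μ q D)
    (hDm : ∀ b ∈ D, MemLp b q μ) {u : ℕ → Lp ℝ p μ} {w : Lp ℝ p μ} {C : ℝ} (hu : ∀ n, ‖u n‖ ≤ C)
    (h : ∀ b ∈ D, Tendsto (fun n => ∫ x, u n x * b x ∂μ) atTop (𝓝 (∫ x, w x * b x ∂μ))) :
    Tendsto (fun n => toWeakSpace ℝ (Lp ℝ p μ) (u n)) atTop (𝓝 (toWeakSpace ℝ (Lp ℝ p μ) w)) := by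
  have hC0 : 0 ≤ C := (norm_nonneg _).trans (hu 0)
  refine (WeakBilin.tendsto_iff_forall_eval_tendsto _ ?_).2 fun Λ => ?_
  · intro x y hxy
    exact (SeparatingDual.eq_iff_forall_dual_eq (R := ℝ)).2 fun Λ => LinearMap.congr_fun hxy Λ
  have : ENNReal.HolderConjugate q p := ENNReal.HolderConjugate.symm
  obtain ⟨g, -, hg⟩ := exists_Lp_dual_repr (p := q) μ hq hp Λ
  have hΛ : ∀ f : Lp ℝ p μ, Λ f = ∫ x, f x * g x ∂μ := fun f => by
    rw [hg f]
    simp only [mul_comm]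
  change Tendsto (fun n => Λ (u n)) atTop (𝓝 (Λ w))
  have hclose : ∀ b ∈ D, ∀ f : Lp ℝ p μ,
      |Λ f - ∫ x, f x * b x ∂μ| ≤ ‖f‖ * (eLpNorm (⇑g - b) q μ).toReal := by
    intro b hb f
    have h1 : Integrable (fun x => f x * g x) μ := (Lp.memLp f).integrable_mul (Lp.memLp g)
    have h2 : Integrable (fun x => f x * b x) μ := (Lp.memLp f).integrable_mul (hDm b hb)
    rw [hΛ, ← integral_sub h1 h2]
    simp only [← mul_sub]
    exact abs_integral_Lp_mul_le f ((Lp.memLp g).sub (hDm b hb))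
  rw [Metric.tendsto_atTop]
  intro η hη
  set δ := η / (2 * (C + ‖w‖ + 1)) with hδ
  have hpos : 0 < C + ‖w‖ + 1 := by positivity
  have hδ0 : 0 < δ := by positivity
  obtain ⟨b, hb, hgb⟩ := hD g (Lp.memLp g) (ENNReal.ofReal δ) (ENNReal.ofReal_pos.2 hδ0)
  have hgb' : (eLpNorm (⇑g - b) q μ).toReal ≤ δ :=
    ENNReal.toReal_le_of_le_ofReal hδ0.le hgb.le
  obtain ⟨N, hN⟩ := Metric.tendsto_atTop.1 (h b hb) (η / 2) (by positivity)
  refine ⟨N, fun n hn => ?_⟩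
  have h1 := (hclose b hb (u n)).trans (mul_le_mul (hu n) hgb' ENNReal.toReal_nonneg hC0)
  have h2 := (hclose b hb w).trans (mul_le_mul_of_nonneg_left hgb' (norm_nonneg w))
  have h3 := hN n hn
  have h4 : (C + ‖w‖) * δ < η / 2 := by
    have : (C + ‖w‖ + 1) * δ = η / 2 := by
      rw [hδ]
      field_simp
    linarith
  rw [Real.dist_eq] at h3 ⊢
  rw [abs_le] at h1 h2
  rw [abs_lt] at h3 ⊢
  constructor <;> linarith [h1.1, h1.2, h2.1, h2.2, h3.1, h3.2]

/-! ### The compactness theorem -/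

theorem lemma3p3 {d : ℕ} {Ω : Type*} [MeasurableSpace Ω]
    (P : Measure Ω) [IsProbabilityMeasure P]
    (τ : PhysSpace d → Ω → Ω) (hτ : IsMeasurePreservingFlow P τ) (herg : IsErgodicFlow P τ)
    (p q : ℝ≥0∞) [Fact (1 ≤ p)] (hp_one : 1 < p) (hp_top : p ≠ ∞)
    (hpq : ENNReal.HolderConjugate p q)
    (Q : Set (PhysSpace d)) (hQ_open : IsOpen Q) (hQ_bdd : Bornology.IsBounded Q)
    (DΩ : Set (Ω → ℝ)) (hDΩ : IsRandomTestSet P DΩ)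
    (DQ : Set (PhysSpace d → ℝ)) (hDQ : IsSpatialTestSet Q DQ)
    (ω₀ : Ω) (hω₀ : ω₀ ∈ admissibleSet P τ p q Q DΩ DQ)
    (ε : ℕ → ℝ) (hε_pos : ∀ n, 0 < ε n) (hε_lim : Tendsto ε atTop (𝓝 0))
    (u : ℕ → Lp ℝ p (volume.restrict Q)) (hu : ∃ C : ℝ, ∀ n, ‖u n‖ ≤ C) :
    ∃ (k : ℕ → ℕ) (v : Lp ℝ p (cylMeasure P Q)),
      StrictMono k ∧
      QuenchedTwoScale P τ Q DΩ DQ ω₀ (fun n => ε (k n)) (fun n => u (k n)) v ∧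
      ‖v‖ ≤ liminf (fun n => ‖u n‖) atTop ∧
      ∃ hv : MemLp (expectation P v) p (volume.restrict Q),
        Tendsto (fun n => toWeakSpace ℝ (Lp ℝ p (volume.restrict Q)) (u (k n))) atTop
          (𝓝 (toWeakSpace ℝ (Lp ℝ p (volume.restrict Q)) (hv.toLp (expectation P v)))) := by
  have : Fact (1 ≤ q) := ⟨ENNReal.HolderConjugate.one_le q p⟩
  have hq_top : q ≠ ∞ := (ENNReal.HolderConjugate.lt_top_iff_one_lt q p).2 hp_one |>.ne
  have : IsFiniteMeasure (volume.restrict Q) := ⟨by simpa using hQ_bdd.measure_lt_top⟩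
  obtain ⟨C, hC⟩ := hu
  -- The norms converge to their lower limit along a first subsequence; by compactness, the final
  -- one can be extracted from it.
  obtain ⟨j, hj, hj_top⟩ := exists_seq_tendsto_liminf (f := atTop) (u := fun n => ‖u n‖)
    (isBoundedUnder_of ⟨C, hC⟩).isCoboundedUnder_ge
    (isBoundedUnder_of ⟨0, fun n => norm_nonneg (u n)⟩)
  obtain ⟨i, hi, hji⟩ := strictMono_subseq_of_tendsto_atTop hj_top
  obtain ⟨k, v, hk, hlim, hv⟩ := exists_quenchedTwoScale_subseq (p := p) (q := q)
    (ε := fun n => ε (j (i n))) (u := fun n => u (j (i n))) hp_top hq_top hτ hDΩ hDQ hQ_open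
    hQ_bdd hω₀ (fun n => hε_pos _) (hε_lim.comp hji.tendsto_atTop) (fun n => hC _)
    (hj.comp hi.tendsto_atTop)
  have hexp : MemLp (expectation P v) p (volume.restrict Q) := memLp_expectation hp_one.le hp_top v
  refine ⟨fun n => j (i (k n)), v, hji.comp hk, hlim, hv, hexp, ?_⟩
  refine tendsto_toWeakSpace_of_dense (q := q) hp_top hq_top
    (hDQ.dense q Fact.out hq_top) (fun b hb => hDQ.memLp hQ_open hQ_bdd hb q) (fun n => hC _)
    fun b hb => ?_
  -- spatial test functions do not oscillate, since `1` is a random test function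
  have h := hlim.2 (fun z => 1 * b z.2) (Submodule.subset_span ⟨_, hDΩ.one_mem, b, hb, rfl⟩)
  have e : ∫ x in Q, hexp.toLp (expectation P v) x * b x =
      ∫ z, v z * (1 * b z.2) ∂(cylMeasure P Q) := by
    simp only [one_mul]
    rw [← integral_expectation_mul (q := q) v (hDQ.memLp hQ_open hQ_bdd hb q)]
    refine integral_congr_ae ?_
    filter_upwards [hexp.coeFn_toLp] with x hx
    rw [hx]
  rw [e]
  refine h.congr fun n => ?_
  simp [unfoldAdj]
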